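/- Let qudits of local dimension $d$ sit at the vertices $(i,j)\in[L]\times[n+1]$ (column $i$, row $j$) of an $L\times(n+1)$ grid, and let $H_0=\sum_{i=1}^{L-1}\sum_{j=1}^{n}h_{ij}$ on $(\mathbb C^d)^{\otimes L(n+1)}$, where each $h_{ij}$ is an orthogonal projector that acts nontrivially only on the qudits in $\{i,i+1\}\times\{j,j+1\}$. Assume that $H_0$ has a unique ground state $|\Omega\rangle$ and that $H_0|\Omega\rangle=0$. For a positive semidefinite operator $M$ let $\mathrm{gap}(M)$ be its smallest nonzero eigenvalue, with $\mathrm{gap}(0)=1$, and define the local gap $$\gamma=\min_{S\subseteq[L-1]\times[n]}\mathrm{gap}\Big(\sum_{(i,j)\in S}h_{ij}\Big).$$ Let $w\ge 2$ and $c$ be integers with $w\le c\le L-w$, and consider the band of the $w$ columns $a+1,\dots,a+w$, $a=c-\lfloor w/2\rfloor$, around the vertical cut between columns $c$ and $c+1$. For $1\le j\le n$ let $\Pi_{L,j}$ and $\Pi_{R,j}$ be the orthogonal projectors onto the nullspaces of $\sum_{1\le i\le a}h_{ij}$ and $\sum_{a+w\le i\le L-1}h_{ij}$ respectively, and define $$H_j=\frac1{2w}\Big(\sum_{a<i<a+w}h_{ij}+(I-\Pi_{L,j})+(I-\Pi_{R,j})\Big).$$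 For $S\subseteq[n]$ let $H_S=\sum_{j\in S}H_j$ and let $\Pi_S$ be the orthogonal projector onto the nullspace of $H_S$. Then there is an absolute constant $\kappa>0$ (independent of $L,n,d,w,c$ and of the $h_{ij}$) such that $\Delta=\kappa\gamma/w$ satisfies $0<\Delta\le1$ and, for every interval $S=\{k,k+1,\dots,l\}\subseteq[n]$ and every partition $S=ABC$ into three consecutive (possibly empty) intervals, $$\mathrm{gap}(H_S)\ge\Delta\qquad\text{and}\qquad\|\Pi_{AB}\Pi_{BC}-\Pi_S\|\le 2e^{-|B|\sqrt{\Delta}},$$ where $\|\cdot\|$ is the operator norm. -/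

import Mathlib

open scoped BigOperators InnerProductSpace

noncomputable section

namespace GridSpin

section Operators

variable {V : Type*} [NormedAddCommGroup V] [InnerProductSpace ℂ V] [FiniteDimensional ℂ V]

/-- The smallest nonzero eigenvalue of a (positive semidefinite) operator,
with the convention that the gap of the zero operator is `1`. -/
def gap (M : V →L[ℂ] V) : ℝ :=
  open Classical in
  if M = 0 then 1
  else sInf {μ : ℝ | μ ≠ 0 ∧ Module.End.HasEigenvalue (M : V →ₗ[ℂ] V) (μ : ℂ)}

/-- The orthogonal projector onto the nullspace of `M`. -/
def nullProj (M : V →L[ℂ] V) : V →L[ℂ] V :=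
  (LinearMap.ker (M : V →ₗ[ℂ] V)).starProjection

/-- `H_S = ∑_{j ∈ S} H_j`. -/
def partialSum (H : ℕ → V →L[ℂ] V) (S : Finset ℕ) : V →L[ℂ] V := ∑ j ∈ S, H j

/-- The operators `H_1, …, H_n` have the gap and merge properties with parameter `Δ ∈ (0,1]`.
Intervals of `{1, …, n}` are written `Finset.Ico a e` with `1 ≤ a` and `e ≤ n + 1`, and a partition
of such an interval into consecutive intervals as `A = Ico a b`, `B = Ico b c`, `C = Ico c e`
(empty intervals are allowed). -/
structure HasGapMerge (n : ℕ) (H : ℕ → V →L[ℂ] V) (Δ : ℝ) : Prop where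
  pos : 0 < Δ
  le_one : Δ ≤ 1
  gap_property : ∀ a e : ℕ, 1 ≤ a → a ≤ e → e ≤ n + 1 →
    Δ ≤ gap (partialSum H (Finset.Ico a e))
  merge_property : ∀ a b c e : ℕ, 1 ≤ a → a ≤ b → b ≤ c → c ≤ e → e ≤ n + 1 →
    ‖nullProj (partialSum H (Finset.Ico a b ∪ Finset.Ico b c)) *
        nullProj (partialSum H (Finset.Ico b c ∪ Finset.Ico c e)) -
        nullProj (partialSum H (Finset.Ico a e))‖
      ≤ 2 * Real.exp (-((Finset.Ico b c).card : ℝ) * √Δ)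

end Operators

/-- The sites `(i, j)`, column `i ∈ {1, …, L}` and row `j ∈ {1, …, n+1}`. -/
abbrev Site (L n : ℕ) : Type := ↥(Finset.Icc 1 L ×ˢ Finset.Icc 1 (n + 1))

/-- The Hilbert space `(ℂ^d)^{⊗ ι}`, written in its product basis, which is
indexed by the configurations `ι → Fin d`. -/
abbrev QuditSpace (ι : Type) [Fintype ι] (d : ℕ) : Type := EuclideanSpace ℂ (ι → Fin d)

/-- `A` acts nontrivially only on the qudits in `T`: it is `B ⊗ I` with `B` an operator on the
qudits in `T` and `I` the identity on the others, in matrix elements `⟨x|A|y⟩`. -/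
def ActsOn {ι : Type} [Fintype ι] [DecidableEq ι] {d : ℕ} (T : Finset ι)
    (A : QuditSpace ι d →L[ℂ] QuditSpace ι d) : Prop :=
  ∃ B : Matrix (T → Fin d) (T → Fin d) ℂ, ∀ x y : ι → Fin d,
    A (EuclideanSpace.single y 1) x =
      if ∀ s, s ∉ T → x s = y s then B (fun s => x s) (fun s => y s) else 0

/-- The plaquette `{i, i+1} × {j, j+1}`. -/
def plaquette (L n i j : ℕ) : Finset (Site L n) :=
  Finset.univ.filter fun p => (p.1.1 = i ∨ p.1.1 = i + 1) ∧ (p.1.2 = j ∨ p.1.2 = j + 1)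

/-- The positions `(i, j)`, `1 ≤ i ≤ L-1`, `1 ≤ j ≤ n`, of the local terms. -/
def positions (L n : ℕ) : Finset (ℕ × ℕ) := Finset.Ico 1 L ×ˢ Finset.Icc 1 n

/-- A frustration-free Hamiltonian `H₀ = ∑ h_{ij}` on the `L × (n+1)` grid of qudits of dimension
`d`, a sum of plaquette projectors, with a unique ground state, which has energy zero.
The values `h i j` at other positions are irrelevant. -/
structure GridSystem (L n d : ℕ) where
  h : ℕ → ℕ → QuditSpace (Site L n) d →L[ℂ] QuditSpace (Site L n) d
  projector : ∀ p ∈ positions L n, IsStarProjection (h p.1 p.2)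
  isLocal : ∀ p ∈ positions L n, ActsOn (plaquette L n p.1 p.2) (h p.1 p.2)
  unique_ground : ∃ Ω : QuditSpace (Site L n) d, ‖Ω‖ = 1 ∧
    ∀ ψ, (∑ p ∈ positions L n, h p.1 p.2) ψ = 0 ↔ ∃ z : ℂ, ψ = z • Ω

namespace GridSystem

variable {L n d : ℕ} (G : GridSystem L n d)

/-- The local gap `γ`: the minimum of `gap (∑_{(i,j) ∈ S} h_{ij})` over all sets `S` of positions. -/
def localGap : ℝ :=
  (positions L n).powerset.inf' ⟨∅, Finset.empty_mem_powerset _⟩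
    fun S => gap (∑ p ∈ S, G.h p.1 p.2)

/-- The projector onto the ground space of the terms `h_{ij}` of row `j` with `i ∈ I`. -/
def rowProj (I : Finset ℕ) (j : ℕ) : QuditSpace (Site L n) d →L[ℂ] QuditSpace (Site L n) d :=
  nullProj (∑ i ∈ I, G.h i j)

/-- The row operator
`H_j = (1/2w) (∑_{a < i < a+w} h_{ij} + (I - Π_{L,j}) + (I - Π_{R,j}))`, where the band consists of
the `w` columns `a+1, …, a+w` with `a = c - ⌊w/2⌋`, so that the cut `(c, c+1)` is in its middle,
and `Π_{L,j}`, `Π_{R,j}` belong to the terms of row `j` with `i ≤ a` and with `i ≥ a + w`. -/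
def rowOp (w c j : ℕ) : QuditSpace (Site L n) d →L[ℂ] QuditSpace (Site L n) d :=
  let a := c - w / 2
  (1 / (2 * (w : ℂ))) •
    (∑ i ∈ Finset.Ico (a + 1) (a + w), G.h i j
      + (1 - G.rowProj (Finset.Ico 1 (a + 1)) j)
      + (1 - G.rowProj (Finset.Ico (a + w) L) j))

end GridSystem

end GridSpin

end

/-! Gap property. A state ψ orthogonal to ker H_S is sent through D, the product of all 1 - h_ij in
the rows of S, arranged in four layers by the parities of i and j. Factors within a layer commute. A
row layer splits into left, band and right parts, and the outer parts fix the ranges of Π_L and Π_R,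
so a layer loses squared norm at most 2w⟨ψ, H_S ψ⟩, whatever L is (`norm_one_sub_rowLayer_sq_le`).
Hence D loses at most 128w⟨ψ, H_S ψ⟩. Conversely, the detectability lemma
`sum_norm_sq_le_of_card_le` bounds the energy of Dψ in ∑ h_ij by 81 times that loss, and this energy
is at least γ‖Dψ‖² because Dψ stays orthogonal to the common kernel. Together γ‖ψ‖² ≤ 82·128·w⟨ψ,
H_S ψ⟩ (`localGap_div_le_gap`).

Merge property (`norm_nullProj_mul_sub_le`). This needs only 0 ≤ H_j ≤ 1, commutation of rows at
distance two or more, and a lower bound Δ₀ on the gap. Let P_j project onto ker H_j, let E and O be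
the products of the P_j over even and odd rows, and Q = Π_S. Detectability makes EO contract the
complement of the ground space, so X = OEO fixes Q and 0 ≤ X - Q ≤ 1 - Δ₀/8. A rescaled Chebyshev
polynomial q of degree m with q(1) = 1 then gives ‖q(X) - Q‖ ≤ 2exp(-m√(Δ₀/8)). By a light-cone
argument (`mul_layers_mul`), a word of at most |B| + 1 layers between Π_AB and Π_BC can be erased:
each factor is absorbed on one side or the other. So if 3m ≤ |B| + 1, then Π_AB Π_BC - Q = Π_AB
(q(X) - Q) Π_BC. -/

open scoped BigOperators InnerProductSpace

noncomputable section

namespace GridSpin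

/-! ### The gap as a quadratic-form bound -/

section Gap

variable {V : Type*} [NormedAddCommGroup V] [InnerProductSpace ℂ V]

lemma isPositive_eigenvalue_nonneg {M : V →L[ℂ] V} (hM : M.IsPositive) {μ : ℝ}
    (hμ : Module.End.HasEigenvalue (M : V →ₗ[ℂ] V) (μ : ℂ)) : 0 ≤ μ :=
  eigenvalue_nonneg_of_nonneg hμ fun x => hM.re_inner_nonneg_right x

/-- For an operator that is bounded below by `Δ` on the orthogonal complement of its kernel, every
nonzero eigenvalue is at least `Δ`. -/
lemma le_eigenvalue_of_forall {M : V →L[ℂ] V} (hM : M.IsPositive) {Δ : ℝ}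
    (h : ∀ φ ∈ (LinearMap.ker (M : V →ₗ[ℂ] V))ᗮ, Δ * ‖φ‖ ^ 2 ≤ (⟪φ, M φ⟫_ℂ).re) {μ : ℝ}
    (hμ0 : μ ≠ 0) (hμ : Module.End.HasEigenvalue (M : V →ₗ[ℂ] V) (μ : ℂ)) : Δ ≤ μ := by
  obtain ⟨v, hv⟩ := hμ.exists_hasEigenvector
  have hMv : M v = (μ : ℂ) • v := hv.apply_eq_smul
  have hv0 : 0 < ‖v‖ ^ 2 := by
    have := norm_pos_iff.2 hv.2
    positivity
  have hmem : v ∈ (LinearMap.ker (M : V →ₗ[ℂ] V))ᗮ := by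
    rw [Submodule.mem_orthogonal]
    intro u hu
    have hu' : M u = 0 := hu
    have h1 : ⟪M u, v⟫_ℂ = ⟪u, M v⟫_ℂ := hM.inner_left_eq_inner_right u v
    rw [hu', hMv, inner_zero_left, inner_smul_right] at h1
    rcases mul_eq_zero.1 h1.symm with h2 | h2
    · exact absurd (by exact_mod_cast h2) hμ0
    · exact h2
  have h1 := h v hmem
  rw [hMv, inner_smul_right, inner_self_eq_norm_sq_to_K] at h1
  have h2 : ((μ : ℂ) * ((‖v‖ : ℂ)) ^ 2).re = μ * ‖v‖ ^ 2 := by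
    norm_cast
  have h3 : Δ * ‖v‖ ^ 2 ≤ μ * ‖v‖ ^ 2 := by
    rw [← h2]; exact h1
  exact le_of_mul_le_mul_right h3 hv0

lemma gap_le_eigenvalue {M : V →L[ℂ] V} (hM : M.IsPositive) (h0 : M ≠ 0) {μ : ℝ} (hμ0 : μ ≠ 0)
    (hμ : Module.End.HasEigenvalue (M : V →ₗ[ℂ] V) (μ : ℂ)) : gap M ≤ μ := by
  unfold gap
  rw [if_neg h0]
  exact csInf_le ⟨0, fun ν hν => isPositive_eigenvalue_nonneg hM hν.2⟩ ⟨hμ0, hμ⟩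

variable [FiniteDimensional ℂ V]

lemma exists_nonzero_eigenvalue {M : V →L[ℂ] V} (hM : M.IsPositive) (h0 : M ≠ 0) :
    ∃ μ : ℝ, μ ≠ 0 ∧ Module.End.HasEigenvalue (M : V →ₗ[ℂ] V) (μ : ℂ) := by
  by_contra hcon
  push Not at hcon
  apply h0
  have hs := hM.isSymmetric
  have hb : ∀ i, (M : V →ₗ[ℂ] V) (hs.eigenvectorBasis rfl i) = 0 := by
    intro i
    have h1 := hs.hasEigenvalue_eigenvalues rfl i
    have h2 : hs.eigenvalues rfl i = 0 := by
      by_contra h3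
      exact hcon _ h3 h1
    rw [hs.apply_eigenvectorBasis rfl i, h2]
    simp
  have h4 : (M : V →ₗ[ℂ] V) = 0 :=
    (hs.eigenvectorBasis rfl).toBasis.ext fun i => by simpa using hb i
  ext x
  exact LinearMap.congr_fun h4 x

/-- The condition `Δ ≤ 1` serves the convention for the zero operator. -/
lemma le_gap_of_forall {M : V →L[ℂ] V} (hM : M.IsPositive) {Δ : ℝ} (hΔ : Δ ≤ 1)
    (h : ∀ φ ∈ (LinearMap.ker (M : V →ₗ[ℂ] V))ᗮ, Δ * ‖φ‖ ^ 2 ≤ (⟪φ, M φ⟫_ℂ).re) :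
    Δ ≤ gap M := by
  unfold gap
  split_ifs with h0
  · exact hΔ
  · exact le_csInf (exists_nonzero_eigenvalue hM h0)
      fun μ hμ => le_eigenvalue_of_forall hM h hμ.1 hμ.2

/-- The infimum is attained, since there are finitely many eigenvalues. -/
lemma gap_pos {M : V →L[ℂ] V} (hM : M.IsPositive) : 0 < gap M := by
  unfold gap
  split_ifs with h0
  · exact one_pos
  · have hfin : {μ : ℝ | μ ≠ 0 ∧ Module.End.HasEigenvalue (M : V →ₗ[ℂ] V) (μ : ℂ)}.Finite := by
      have h1 := Module.End.finite_hasEigenvalue (M : V →ₗ[ℂ] V)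
      exact (h1.preimage (f := fun μ : ℝ => (μ : ℂ)) Complex.ofReal_injective.injOn).subset
        fun μ hμ => hμ.2
    have hmem := Set.Nonempty.csInf_mem (exists_nonzero_eigenvalue hM h0) hfin
    exact lt_of_le_of_ne (isPositive_eigenvalue_nonneg hM hmem.2) (Ne.symm hmem.1)

/-- Expand in an eigenbasis: the basis vectors of eigenvalue zero lie in the kernel and have no
overlap with `φ`; the other eigenvalues are at least the gap. -/
lemma gap_mul_norm_sq_le {M : V →L[ℂ] V} (hM : M.IsPositive) {φ : V}
    (hφ : φ ∈ (LinearMap.ker (M : V →ₗ[ℂ] V))ᗮ) : gap M * ‖φ‖ ^ 2 ≤ (⟪φ, M φ⟫_ℂ).re := by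
  by_cases h0 : M = 0
  · subst h0
    have : φ = 0 := by simpa using hφ
    simp [this]
  have hs := hM.isSymmetric
  set b := hs.eigenvectorBasis rfl with hb
  have hin : ⟪φ, M φ⟫_ℂ = ∑ i, ⟪φ, b i⟫_ℂ * ⟪b i, M φ⟫_ℂ := (b.sum_inner_mul_inner φ (M φ)).symm
  have hterm : ∀ i, ⟪φ, b i⟫_ℂ * ⟪b i, M φ⟫_ℂ
      = ((hs.eigenvalues rfl i * ‖⟪b i, φ⟫_ℂ‖ ^ 2 : ℝ) : ℂ) := by
    intro i
    have h1 : ⟪M (b i), φ⟫_ℂ = ⟪b i, M φ⟫_ℂ := hM.inner_left_eq_inner_right _ _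
    have h2 : M (b i) = ((hs.eigenvalues rfl i : ℝ) : ℂ) • b i := hs.apply_eigenvectorBasis rfl i
    rw [← h1, h2, inner_smul_left, Complex.conj_ofReal, ← inner_conj_symm φ (b i)]
    rw [mul_left_comm, ← Complex.normSq_eq_conj_mul_self, Complex.normSq_eq_norm_sq]
    push_cast
    ring
  have hsum : (⟪φ, M φ⟫_ℂ).re = ∑ i, hs.eigenvalues rfl i * ‖⟪b i, φ⟫_ℂ‖ ^ 2 := by
    rw [hin, Finset.sum_congr rfl fun i _ => hterm i, ← Complex.ofReal_sum, Complex.ofReal_re]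
  rw [hsum, ← b.sum_sq_norm_inner_right φ, Finset.mul_sum]
  refine Finset.sum_le_sum fun i _ => ?_
  have hev := hs.hasEigenvalue_eigenvalues rfl i
  by_cases hz : hs.eigenvalues rfl i = 0
  · have hker : b i ∈ LinearMap.ker (M : V →ₗ[ℂ] V) := by
      rw [LinearMap.mem_ker, hb, hs.apply_eigenvectorBasis rfl i, hz]
      simp
    have : ⟪b i, φ⟫_ℂ = 0 := (Submodule.mem_orthogonal _ _).1 hφ _ hker
    simp [this]
  · exact mul_le_mul_of_nonneg_right (gap_le_eigenvalue hM h0 hz hev) (by positivity)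

end Gap

/-! ### Projectors onto nullspaces -/

section NullProj

variable {V : Type*} [NormedAddCommGroup V] [InnerProductSpace ℂ V] [FiniteDimensional ℂ V]

lemma nullProj_apply_eq_self {M : V →L[ℂ] V} {v : V} (h : M v = 0) : nullProj M v = v :=
  Submodule.starProjection_eq_self_iff.2 h

lemma apply_nullProj (M : V →L[ℂ] V) (v : V) : M (nullProj M v) = 0 :=
  Submodule.starProjection_apply_mem (LinearMap.ker (M : V →ₗ[ℂ] V)) v

lemma sub_nullProj_mem_orthogonal (M : V →L[ℂ] V) (v : V) :
    v - nullProj M v ∈ (LinearMap.ker (M : V →ₗ[ℂ] V))ᗮ :=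
  Submodule.sub_starProjection_mem_orthogonal v

lemma norm_nullProj_le (M : V →L[ℂ] V) : ‖nullProj M‖ ≤ 1 := Submodule.starProjection_norm_le _

lemma isPositive_apply_eq_zero {M : V →L[ℂ] V} (hM : M.IsPositive) {v : V}
    (h : (⟪v, M v⟫_ℂ).re = 0) : M v = 0 := by
  by_contra hne
  have h1 := gap_mul_norm_sq_le hM (sub_nullProj_mem_orthogonal M v)
  have h2 : M (v - nullProj M v) = M v := by rw [map_sub, apply_nullProj, sub_zero]
  have h3 : ⟪nullProj M v, M v⟫_ℂ = 0 := by
    rw [← hM.inner_left_eq_inner_right, apply_nullProj, inner_zero_left]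
  rw [h2, inner_sub_left, h3, sub_zero, h] at h1
  have h4 : ‖v - nullProj M v‖ ^ 2 ≤ 0 := by
    by_contra h5
    exact absurd h1 (not_le.2 (mul_pos (gap_pos hM) (not_le.1 h5)))
  have h5 : v - nullProj M v = 0 := by
    rw [← norm_eq_zero]; exact pow_eq_zero_iff two_ne_zero |>.1 (le_antisymm h4 (by positivity))
  exact hne (by rw [← h2, h5, map_zero])

/-- The kernel of a sum of positive operators is the intersection of the kernels. -/
lemma sum_apply_eq_zero_iff {ι : Type*} {s : Finset ι} {M : ι → V →L[ℂ] V}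
    (hM : ∀ i ∈ s, (M i).IsPositive) {v : V} :
    (∑ i ∈ s, M i) v = 0 ↔ ∀ i ∈ s, M i v = 0 := by
  constructor
  · intro h i hi
    refine isPositive_apply_eq_zero (hM i hi) ?_
    have h1 : ∑ i ∈ s, (⟪v, M i v⟫_ℂ).re = 0 := by
      rw [← Complex.re_sum, ← inner_sum, ← sum_apply, h]
      simp
    exact (Finset.sum_eq_zero_iff_of_nonneg
      fun i hi => (hM i hi).re_inner_nonneg_right v).1 h1 i hi
  · intro h
    rw [sum_apply]
    exact Finset.sum_eq_zero h

lemma nullProj_mul_of_ker_le {M N : V →L[ℂ] V} (h : ∀ v, M v = 0 → N v = 0) :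
    nullProj N * nullProj M = nullProj M := by
  ext v
  exact nullProj_apply_eq_self (h _ (apply_nullProj M v))

variable [CompleteSpace V]

lemma isStarProjection_nullProj (M : V →L[ℂ] V) : IsStarProjection (nullProj M) :=
  isStarProjection_starProjection

/-- The null projector of `M` commutes with every self-adjoint operator that commutes with `M`. -/
lemma commute_nullProj {M A : V →L[ℂ] V} (hA : IsSelfAdjoint A) (h : Commute A M) :
    Commute A (nullProj M) := by
  have key : nullProj M * A * nullProj M = A * nullProj M := by
    ext v
    refine nullProj_apply_eq_self ?_
    have : M (A (nullProj M v)) = A (M (nullProj M v)) :=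
      (DFunLike.congr_fun h.eq (nullProj M v)).symm
    exact this.trans (by rw [apply_nullProj, map_zero])
  -- `A` preserves the kernel; taking adjoints shows that it preserves the complement as well.
  have h2 := congrArg star key
  have hP := (isStarProjection_nullProj M).isSelfAdjoint.star_eq
  rw [star_mul, star_mul, star_mul, hA.star_eq, hP, ← mul_assoc, key] at h2
  exact h2

lemma nullProj_mul_of_ker_le' {M N : V →L[ℂ] V} (h : ∀ v, M v = 0 → N v = 0) :
    nullProj M * nullProj N = nullProj M := by
  have h2 := congrArg star (nullProj_mul_of_ker_le h)
  rwa [star_mul, (isStarProjection_nullProj M).isSelfAdjoint.star_eq,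
    (isStarProjection_nullProj N).isSelfAdjoint.star_eq] at h2

end NullProj

/-! ### Products of projections and union bounds -/

section Projections

variable {V : Type*} [NormedAddCommGroup V] [InnerProductSpace ℂ V] [CompleteSpace V]

lemma re_inner_isStarProjection {p : V →L[ℂ] V} (hp : IsStarProjection p) (v : V) :
    (⟪v, p v⟫_ℂ).re = ‖p v‖ ^ 2 := by
  have hs := ContinuousLinearMap.isSelfAdjoint_iff_isSymmetric.1 hp.isSelfAdjoint
  have h1 : p (p v) = p v := DFunLike.congr_fun hp.isIdempotentElem.eq v
  have h2 : ⟪p v, p v⟫_ℂ = ⟪v, p (p v)⟫_ℂ := hs v (p v)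
  rw [← h1, ← h2, h1, inner_self_eq_norm_sq_to_K]
  norm_cast

lemma norm_sq_add_norm_sq {p : V →L[ℂ] V} (hp : IsStarProjection p) (v : V) :
    ‖p v‖ ^ 2 + ‖(1 - p) v‖ ^ 2 = ‖v‖ ^ 2 := by
  rw [← re_inner_isStarProjection hp, ← re_inner_isStarProjection hp.one_sub, ← Complex.add_re,
    ← inner_add_right]
  have : p v + (1 - p) v = v := by simp
  rw [this, inner_self_eq_norm_sq_to_K]
  norm_cast

lemma norm_isStarProjection_apply_le {p : V →L[ℂ] V} (hp : IsStarProjection p) (v : V) :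
    ‖p v‖ ≤ ‖v‖ := by
  have h := norm_sq_add_norm_sq hp v
  exact le_of_sq_le_sq (by nlinarith [sq_nonneg ‖(1 - p) v‖]) (norm_nonneg v)

/-- A self-adjoint operator fixing `K` pointwise preserves `Kᗮ`. This keeps swept states where the
gap estimate applies. -/
lemma list_prod_mem_orthogonal {l : List (V →L[ℂ] V)} (hl : ∀ p ∈ l, IsSelfAdjoint p)
    {K : Submodule ℂ V} (hK : ∀ p ∈ l, ∀ v ∈ K, p v = v) {ψ : V} (hψ : ψ ∈ Kᗮ) :
    l.prod ψ ∈ Kᗮ := by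
  induction l with
  | nil => simpa using hψ
  | cons p l ih =>
    have ih' := ih (fun q hq => hl q (by simp [hq])) (fun q hq => hK q (by simp [hq]))
    rw [List.prod_cons, Submodule.mem_orthogonal]
    intro u hu
    have hs := ContinuousLinearMap.isSelfAdjoint_iff_isSymmetric.1 (hl p (by simp))
    have h1 : ⟪p u, l.prod ψ⟫_ℂ = ⟪u, p (l.prod ψ)⟫_ℂ := hs u _
    rw [hK p (by simp) u hu] at h1
    exact h1.symm.trans ((Submodule.mem_orthogonal _ _).1 ih' u hu)

lemma list_prod_mul_eq {R : Type*} [Monoid R] {l : List R} {x : R} (h : ∀ p ∈ l, p * x = x) :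
    l.prod * x = x := by
  induction l with
  | nil => simp
  | cons p l ih =>
    rw [List.prod_cons, mul_assoc, ih fun q hq => h q (by simp [hq]), h p (by simp)]

lemma mul_list_prod_eq {R : Type*} [Monoid R] {l : List R} {x : R} (h : ∀ p ∈ l, x * p = x) :
    x * l.prod = x := by
  induction l with
  | nil => simp
  | cons p l ih =>
    rw [List.prod_cons, ← mul_assoc, h p (by simp), ih fun q hq => h q (by simp [hq])]

/-- A product of pairwise commuting projections is a projection. -/
lemma isStarProjection_list_prod {l : List (V →L[ℂ] V)} (hl : ∀ p ∈ l, IsStarProjection p)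
    (hc : ∀ p ∈ l, ∀ q ∈ l, Commute p q) : IsStarProjection l.prod := by
  induction l with
  | nil => simp
  | cons p l ih =>
    rw [List.prod_cons]
    refine (hl p (by simp)).mul (ih (fun q hq => hl q (by simp [hq]))
      fun q hq r hr => hc q (by simp [hq]) r (by simp [hr])) ?_
    exact Commute.list_prod_right _ _ fun q hq => hc p (by simp) q (by simp [hq])

/-- The union bound for two commuting projections. -/
lemma norm_one_sub_mul_sq_le {p q : V →L[ℂ] V} (hp : IsStarProjection p) (hq : IsStarProjection q)
    (hc : Commute p q) (v : V) :
    ‖(1 - p * q) v‖ ^ 2 ≤ ‖(1 - p) v‖ ^ 2 + ‖(1 - q) v‖ ^ 2 := by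
  have h1 := norm_sq_add_norm_sq (hp.mul hq hc) v
  have h2 := norm_sq_add_norm_sq hp (q v)
  have h3 := norm_sq_add_norm_sq hq v
  have h4 : (1 - p) (q v) = q ((1 - p) v) :=
    DFunLike.congr_fun ((Commute.one_left q).sub_left hc).eq v
  have h5 := norm_isStarProjection_apply_le hq ((1 - p) v)
  rw [h4] at h2
  have h6 : (p * q) v = p (q v) := rfl
  rw [h6] at h1
  have h7 : ‖q ((1 - p) v)‖ ^ 2 ≤ ‖(1 - p) v‖ ^ 2 := by gcongr
  linarith

/-- The union bound for a list of commuting projections. -/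
lemma norm_one_sub_list_prod_sq_le {l : List (V →L[ℂ] V)} (hl : ∀ p ∈ l, IsStarProjection p)
    (hc : ∀ p ∈ l, ∀ q ∈ l, Commute p q) (v : V) :
    ‖(1 - l.prod) v‖ ^ 2 ≤ (l.map fun p => ‖(1 - p) v‖ ^ 2).sum := by
  induction l with
  | nil => simp
  | cons p l ih =>
    have hl' : ∀ q ∈ l, IsStarProjection q := fun q hq => hl q (by simp [hq])
    have hc' : ∀ q ∈ l, ∀ r ∈ l, Commute q r := fun q hq r hr => hc q (by simp [hq]) r (by simp [hr])
    rw [List.prod_cons, List.map_cons, List.sum_cons]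
    refine (norm_one_sub_mul_sq_le (hl p (by simp)) (isStarProjection_list_prod hl' hc')
      (Commute.list_prod_right _ _ fun q hq => hc p (by simp) q (by simp [hq])) v).trans ?_
    gcongr
    exact ih hl' hc'

lemma norm_one_sub_list_prod_le {l : List (V →L[ℂ] V)} (hl : ∀ p ∈ l, IsStarProjection p)
    {v : V} {ε : ℝ} (hε : ∀ p ∈ l, ‖(1 - p) v‖ ≤ ε) : ‖(1 - l.prod) v‖ ≤ l.length * ε := by
  induction l with
  | nil => simp
  | cons p l ih =>
    have h1 := ih (fun q hq => hl q (by simp [hq])) (fun q hq => hε q (by simp [hq]))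
    have h2 : (1 - (p :: l).prod) v = p ((1 - l.prod) v) + (1 - p) v := by simp
    rw [h2, List.length_cons, Nat.cast_succ]
    have h3 := norm_add_le (p ((1 - l.prod) v)) ((1 - p) v)
    have h4 := norm_isStarProjection_apply_le (hl p (by simp)) ((1 - l.prod) v)
    have h5 := hε p (by simp)
    linarith

/-- The union bound for a list of projections that need not commute. -/
lemma norm_sq_sub_norm_list_prod_sq_le {l : List (V →L[ℂ] V)} (hl : ∀ p ∈ l, IsStarProjection p)
    {v : V} {ε : ℝ} (hε : ∀ p ∈ l, ‖(1 - p) v‖ ≤ ε) :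
    ‖v‖ ^ 2 - ‖l.prod v‖ ^ 2 ≤ l.length ^ 3 * ε ^ 2 := by
  induction l with
  | nil => simp
  | cons p l ih =>
    have hl' : ∀ q ∈ l, IsStarProjection q := fun q hq => hl q (by simp [hq])
    have hε' : ∀ q ∈ l, ‖(1 - q) v‖ ≤ ε := fun q hq => hε q (by simp [hq])
    have h0 : 0 ≤ ε := (norm_nonneg _).trans (hε p (by simp))
    have h1 := ih hl' hε'
    have h2 := norm_one_sub_list_prod_le hl' hε'
    have h3 := norm_sq_add_norm_sq (hl p (by simp)) (l.prod v)
    -- Bounding the loss of each projection separately keeps the total quadratic in `ε`; the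
    -- triangle inequality between `v` and `l.prod v` would give only a linear bound.
    have h4 : (1 - p) (l.prod v) = (1 - p) v - (1 - p) ((1 - l.prod) v) := by
      simp only [sub_apply, one_apply_eq_self, map_sub]; abel
    have h5 : ‖(1 - p) (l.prod v)‖ ≤ (l.length + 1) * ε := by
      rw [h4]
      have h6 := norm_sub_le ((1 - p) v) ((1 - p) ((1 - l.prod) v))
      have h7 := norm_isStarProjection_apply_le (hl p (by simp)).one_sub ((1 - l.prod) v)
      have h8 := hε p (by simp)
      linarith
    have h6 : ‖(1 - p) (l.prod v)‖ ^ 2 ≤ ((l.length + 1) * ε) ^ 2 := by gcongr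
    have h7 : (p :: l).prod v = p (l.prod v) := by simp
    rw [h7, List.length_cons]
    push_cast
    have h8 : (0 : ℝ) ≤ l.length := by positivity
    have h9 : (l.length : ℝ) ^ 3 * ε ^ 2 + ((l.length + 1) * ε) ^ 2
        ≤ ((l.length : ℝ) + 1) ^ 3 * ε ^ 2 := by
      have : 0 ≤ (2 * (l.length : ℝ) ^ 2 + l.length) * ε ^ 2 := by positivity
      nlinarith
    linarith

end Projections

/-! ### The detectability lemma -/

section Detectability

variable {V : Type*} [NormedAddCommGroup V] [InnerProductSpace ℂ V] [CompleteSpace V]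
variable {ι : Type*} [DecidableEq ι]

open Classical in
/-- The energies of the state `φ = ∏ (1 - h k) ψ` are controlled by the norms `e b` that are lost
in the successive projections. -/
lemma exists_defects (h : ι → V →L[ℂ] V) (l : List ι) (hnd : l.Nodup)
    (hh : ∀ k ∈ l, IsStarProjection (h k)) (ψ : V) :
    ∃ e : ι → ℝ, (∀ b, 0 ≤ e b) ∧
      ∑ b ∈ l.toFinset, e b ^ 2 = ‖ψ‖ ^ 2 - ‖(l.map fun k => 1 - h k).prod ψ‖ ^ 2 ∧
      ∀ k ∈ l, ‖h k ((l.map fun k => 1 - h k).prod ψ)‖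
        ≤ ∑ b ∈ l.toFinset with ¬ Commute (h k) (h b), e b := by
  induction l with
  | nil => exact ⟨fun _ => 0, by simp, by simp, by simp⟩
  | cons a l ih =>
    rw [List.nodup_cons] at hnd
    obtain ⟨e, he0, hesum, hek⟩ := ih hnd.2 fun k hk => hh k (by simp [hk])
    set x := (l.map fun k => 1 - h k).prod ψ with hx
    have hcons : ((a :: l).map fun k => 1 - h k).prod ψ = (1 - h a) x := by
      rw [List.map_cons, List.prod_cons]; rfl
    have hal : a ∉ l.toFinset := by simpa using hnd.1
    have hne : ∀ b ∈ l.toFinset, Function.update e a ‖h a x‖ b = e b := fun b hb =>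
      Function.update_of_ne (ne_of_mem_of_not_mem hb hal) _ _
    have ha := hh a (by simp)
    -- The head of the list acts last, so its defect is measured on `x`, the state left by the tail.
    refine ⟨Function.update e a ‖h a x‖, ?_, ?_, ?_⟩
    · intro b
      by_cases hb : b = a
      · subst hb; simp
      · rw [Function.update_of_ne hb]; exact he0 b
    · rw [List.toFinset_cons, Finset.sum_insert hal, Function.update_self,
        Finset.sum_congr rfl fun b hb => by rw [hne b hb], hesum, hcons]
      have := norm_sq_add_norm_sq ha x
      linarith
    · intro k hk
      rw [hcons]
      have hfil : ∑ b ∈ l.toFinset with ¬ Commute (h k) (h b), Function.update e a ‖h a x‖ b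
          = ∑ b ∈ l.toFinset with ¬ Commute (h k) (h b), e b :=
        Finset.sum_congr rfl fun b hb => hne b (Finset.mem_filter.1 hb).1
      rw [List.toFinset_cons, Finset.filter_insert]
      by_cases hka : k = a
      · subst hka
        have h0 : h k ((1 - h k) x) = 0 := DFunLike.congr_fun ha.mul_one_sub_self x
        rw [h0, norm_zero]
        refine Finset.sum_nonneg fun b _ => ?_
        by_cases hb : b = k
        · subst hb; simp
        · rw [Function.update_of_ne hb]; exact he0 b
      have hkl : k ∈ l := by simpa [hka] using hk
      have hp := hh k hk
      by_cases hc : Commute (h k) (h a)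
      · rw [if_neg (not_not.2 hc), hfil]
        have h1 : h k ((1 - h a) x) = (1 - h a) (h k x) :=
          DFunLike.congr_fun ((Commute.one_right _).sub_right hc).eq x
        rw [h1]
        exact (norm_isStarProjection_apply_le ha.one_sub _).trans (hek k hkl)
      -- Without commutation, `‖h k ·‖` grows by at most the defect `‖h a x‖` just created.
      · rw [if_pos hc, Finset.sum_insert (fun hm => hal (Finset.mem_filter.1 hm).1),
          Function.update_self, hfil]
        have h1 : h k ((1 - h a) x) = h k x - h k (h a x) := by simp
        rw [h1]
        have h2 := norm_sub_le (h k x) (h k (h a x))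
        have h3 := norm_isStarProjection_apply_le hp (h a x)
        have h4 := hek k hkl
        linarith

open Classical in
/-- The detectability lemma. -/
lemma sum_norm_sq_le_of_card_le (h : ι → V →L[ℂ] V) (l : List ι) (hnd : l.Nodup)
    (hh : ∀ k ∈ l, IsStarProjection (h k)) (g : ℕ)
    (hg : ∀ k ∈ l, (l.toFinset.filter fun b => ¬ Commute (h k) (h b)).card ≤ g) (ψ : V) :
    ∑ k ∈ l.toFinset, ‖h k ((l.map fun k => 1 - h k).prod ψ)‖ ^ 2
      ≤ g ^ 2 * (‖ψ‖ ^ 2 - ‖(l.map fun k => 1 - h k).prod ψ‖ ^ 2) := by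
  obtain ⟨e, he0, hesum, hek⟩ := exists_defects h l hnd hh ψ
  rw [← hesum]
  have h1 : ∀ k ∈ l.toFinset, ‖h k ((l.map fun k => 1 - h k).prod ψ)‖ ^ 2
      ≤ g * ∑ b ∈ l.toFinset with ¬ Commute (h k) (h b), e b ^ 2 := by
    intro k hk
    have hkl : k ∈ l := by simpa using hk
    have h2 : ‖h k ((l.map fun k => 1 - h k).prod ψ)‖ ^ 2
        ≤ (∑ b ∈ l.toFinset with ¬ Commute (h k) (h b), e b) ^ 2 := by
      gcongr; exact hek k hkl
    -- Cauchy–Schwarz costs one factor `g`; the second comes from exchanging the sums,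
    -- non-commutation being symmetric.
    refine h2.trans (sq_sum_le_card_mul_sum_sq.trans ?_)
    refine mul_le_mul_of_nonneg_right ?_ (Finset.sum_nonneg fun b _ => sq_nonneg _)
    exact_mod_cast hg k hkl
  refine (Finset.sum_le_sum h1).trans ?_
  rw [← Finset.mul_sum]
  simp only [Finset.sum_filter]
  rw [Finset.sum_comm, sq, mul_assoc]
  refine mul_le_mul_of_nonneg_left ?_ (by positivity)
  rw [Finset.mul_sum]
  refine Finset.sum_le_sum fun b hb => ?_
  rw [← Finset.sum_filter, Finset.sum_const, nsmul_eq_mul]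
  refine mul_le_mul_of_nonneg_right ?_ (sq_nonneg _)
  have h3 := hg b (by simpa using hb)
  simp only [Commute.symm_iff (a := h b)] at h3
  exact_mod_cast h3

end Detectability

/-! ### The Chebyshev filter -/

section Chebyshev

open Polynomial in
/-- The rescaled Chebyshev polynomials. -/
lemma exists_chebyshev_filter {δ : ℝ} (h0 : 0 < δ) (h1 : δ < 1) (m : ℕ) :
    ∃ q : ℝ[X], q.natDegree ≤ m ∧ q.eval 1 = 1 ∧
      ∀ x, 0 ≤ x → x ≤ 1 - δ → |q.eval x| ≤ 2 * Real.exp (-(m * √δ)) := by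
  -- The square root of the gap enters here: `T_m (cosh θ) = cosh (m θ)`, while `cosh θ` is within
  -- `δ = θ ^ 2` of `1`.
  set θ := √δ with hθ
  have hθ2 : θ ^ 2 = δ := Real.sq_sqrt h0.le
  have hcosh : Real.cosh θ ≤ 1 + δ := by
    refine (Real.cosh_le_exp_half_sq θ).trans ?_
    rw [hθ2]
    have h2 : 1 - δ / 2 ≤ Real.exp (-(δ / 2)) := Real.one_sub_le_exp_neg _
    have h3 : Real.exp (δ / 2) * Real.exp (-(δ / 2)) = 1 := by rw [← Real.exp_add]; simp
    have h4 := Real.exp_pos (δ / 2)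
    have h5 : Real.exp (δ / 2) * (1 - δ / 2) ≤ 1 := by nlinarith
    nlinarith
  have hpos : 0 < Real.cosh (m * θ) := Real.cosh_pos _
  set s := Real.cosh θ + 1 with hs
  have hs1 : 2 ≤ s := by have := Real.one_le_cosh θ; linarith
  -- The map `x ↦ s x - 1` sends `1` to `cosh θ` and `[0, 1 - δ]` into `[-1, 1]`, where `|T_m| ≤ 1`.
  refine ⟨C (Real.cosh (m * θ))⁻¹ * (Chebyshev.T ℝ m).comp (C s * X - 1), ?_, ?_, ?_⟩
  · refine (natDegree_C_mul_le _ _).trans (natDegree_comp_le.trans ?_)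
    have h2 : (C s * X - 1 : ℝ[X]).natDegree ≤ 1 := by
      refine (natDegree_sub_le _ _).trans ?_
      simpa using (natDegree_C_mul_le s X).trans natDegree_X_le
    rw [Chebyshev.natDegree_T]
    simpa using Nat.mul_le_mul_left m h2
  · have h2 : s - 1 = Real.cosh θ := by rw [hs]; ring
    have h3 := Chebyshev.T_real_cosh θ (m : ℤ)
    simp only [eval_mul, eval_C, eval_comp, eval_sub, eval_X, eval_one, mul_one, h2, h3]
    push_cast
    exact inv_mul_cancel₀ hpos.ne'
  · intro x hx0 hx1
    have hy : |s * x - 1| ≤ 1 := by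
      rw [abs_le]
      constructor
      · nlinarith
      · have : s * x ≤ (2 + δ) * (1 - δ) := by
          have : s ≤ 2 + δ := by linarith
          exact mul_le_mul this hx1 hx0 (by linarith)
        nlinarith
    have h2 := Chebyshev.abs_eval_T_real_le_one (m : ℤ) hy
    simp only [eval_mul, eval_C, eval_comp, eval_sub, eval_X, eval_one]
    rw [abs_mul, abs_of_pos (inv_pos.2 hpos)]
    have h3 : (Real.cosh (m * θ))⁻¹ ≤ 2 * Real.exp (-(m * θ)) := by
      rw [inv_le_iff_one_le_mul₀ hpos, Real.cosh_eq]
      have h4 : Real.exp (-(m * θ)) * Real.exp (m * θ) = 1 := by rw [← Real.exp_add]; simp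
      nlinarith [Real.exp_pos (-(m * θ))]
    calc _ ≤ (Real.cosh (m * θ))⁻¹ * 1 := by gcongr
      _ ≤ _ := by rwa [mul_one]

end Chebyshev

/-! ### Polynomials in an operator -/

section PolynomialCalculus

open Polynomial

lemma norm_aeval_le_of_nonneg {A : Type*} [CStarAlgebra A] [PartialOrder A] [StarOrderedRing A]
    {Y : A} (hY : 0 ≤ Y) {r : ℝ} (hr : ‖Y‖ ≤ r) {q : ℝ[X]} {ε : ℝ} (hε : 0 ≤ ε)
    (hq : ∀ x, 0 ≤ x → x ≤ r → |q.eval x| ≤ ε) : ‖aeval Y q‖ ≤ ε := by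
  have hsa : IsSelfAdjoint Y := IsSelfAdjoint.of_nonneg hY
  rw [← cfc_polynomial q Y hsa]
  refine norm_cfc_le hε fun x hx => ?_
  cases subsingleton_or_nontrivial A
  · simp [spectrum.of_subsingleton] at hx
  refine hq x (spectrum_nonneg_of_nonneg hY hx) ?_
  exact (le_abs_self x).trans ((spectrum.norm_le_norm_of_mem hx).trans hr)

variable {A : Type*} [Ring A] [Algebra ℝ A]

/-- When all powers have the same sandwich, only the sum of the coefficients survives. -/
lemma mul_aeval_mul_eq {x X y z : A} {q : ℝ[X]} (h : ∀ k ≤ q.natDegree, x * X ^ k * y = z) :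
    x * aeval X q * y = q.eval 1 • z := by
  rw [aeval_eq_sum_range, eval_eq_sum_range, Finset.mul_sum, Finset.sum_mul, Finset.sum_smul]
  refine Finset.sum_congr rfl fun k hk => ?_
  rw [mul_smul_comm, smul_mul_assoc, h k (by simpa [Nat.lt_succ_iff] using hk)]
  simp

/-- A polynomial in an operator `X` that fixes the range of the projector `P`. -/
lemma aeval_sub_eq {X P : A} (hP : P * P = P) (h1 : X * P = P) (h2 : P * X = P) {q : ℝ[X]}
    (hq : q.eval 1 = 1) : aeval X q - P = aeval (X - P) q * (1 - P) := by
  have hXk : ∀ k, X ^ k * P = P := by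
    intro k
    induction k with
    | zero => simp
    | succ k ih => rw [pow_succ, mul_assoc, h1, ih]
  -- `X` and `X - P` agree on the range of `1 - P` and preserve it.
  have hk : ∀ k, X ^ k * (1 - P) = (X - P) ^ k * (1 - P) := by
    intro k
    induction k with
    | zero => simp
    | succ k ih =>
      have hc : (X - P) * (1 - P) = (1 - P) * X := by
        simp only [sub_mul, mul_sub, mul_one, one_mul, h1, h2, hP]; abel
      have hc2 : X * (1 - P) = (1 - P) * X := by
        simp only [sub_mul, mul_sub, mul_one, one_mul, h1, h2]
      rw [pow_succ, pow_succ, mul_assoc, mul_assoc, hc, hc2, ← mul_assoc, ← mul_assoc, ih]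
  have e1 : aeval X q * P = P := by
    have := mul_aeval_mul_eq (x := 1) (y := P) (z := P) (q := q) (X := X)
      fun k _ => by rw [one_mul, hXk]
    rwa [one_mul, hq, one_smul] at this
  have e2 : aeval X q * (1 - P) = aeval (X - P) q * (1 - P) := by
    rw [aeval_eq_sum_range, aeval_eq_sum_range, Finset.sum_mul, Finset.sum_mul]
    refine Finset.sum_congr rfl fun k _ => ?_
    rw [smul_mul_assoc, smul_mul_assoc, hk]
  rw [← e2, mul_sub, mul_one, e1]

end PolynomialCalculus

/-! ### Parity layers and the light cone -/

section LightCone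

/-- The product of the `P j` with `j` of parity `q` in the interval of length `len` from `x`. -/
def parityLayer {R : Type*} [Monoid R] (P : ℕ → R) (q x len : ℕ) : R :=
  (((List.range' x len).filter fun j => j % 2 = q).map P).prod

/-- Factors are ordered by index, so cutting the interval cuts the product without any commutation.
-/
lemma parityLayer_add {R : Type*} [Monoid R] (P : ℕ → R) (q x k k' : ℕ) :
    parityLayer P q x (k + k') = parityLayer P q x k * parityLayer P q (x + k) k' := by
  unfold parityLayer
  rw [← List.prod_append, ← List.map_append, ← List.filter_append]
  congr 3
  simp

/-- In a word of layers, the factors outside of a growing light cone are absorbed to the left. -/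
lemma exists_lightCone {R : Type*} [Monoid R] {P : ℕ → R} {a c e : ℕ} (hac : a ≤ c) (hce : c ≤ e)
    (hc : ∀ i j, a ≤ i → i + 2 ≤ j → j < e → Commute (P i) (P j)) {x : R}
    (hx : ∀ j, a ≤ j → j < c → x * P j = x) (qs : List ℕ) :
    ∃ W ∈ Submonoid.closure {p | ∃ j, a ≤ j ∧ j < e ∧ c < j + qs.length ∧ p = P j},
      x * (qs.map fun q => parityLayer P q a (e - a)).prod = x * W := by
  induction qs using List.reverseRecOn with
  | nil => exact ⟨1, one_mem _, by simp⟩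
  | append_singleton qs q ih =>
    obtain ⟨W, hW, hxW⟩ := ih
    set t := qs.length with ht
    -- After `t` layers `W` has indices above `c - t`. Factors of the next layer with index below `c
    -- - t` are at distance at least two from these, so they pass through `W` and are absorbed by
    -- `x`; the cone descends by one index. Truncation to `k = 0` splits off nothing.
    set k := c - t - a with hk
    have hsplit : parityLayer P q a (e - a)
        = parityLayer P q a k * parityLayer P q (a + k) (e - a - k) := by
      rw [← parityLayer_add]; congr 1; omega
    have hF : x * parityLayer P q a k = x := by
      refine mul_list_prod_eq fun p hp => ?_
      simp only [List.mem_map, List.mem_filter, List.mem_range'_1] at hp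
      obtain ⟨j, ⟨hj, -⟩, rfl⟩ := hp
      exact hx j hj.1 (by omega)
    have hFW : Commute W (parityLayer P q a k) := by
      refine Commute.list_prod_right _ _ fun p hp => ?_
      simp only [List.mem_map, List.mem_filter, List.mem_range'_1] at hp
      obtain ⟨j, ⟨hj, -⟩, rfl⟩ := hp
      have hle : Submonoid.closure {p | ∃ j, a ≤ j ∧ j < e ∧ c < j + t ∧ p = P j}
          ≤ Submonoid.centralizer {P j} := by
        rw [Submonoid.closure_le]
        rintro _ ⟨i, hi1, hi2, hi3, rfl⟩
        rw [SetLike.mem_coe, Submonoid.mem_centralizer_iff]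
        rintro _ rfl
        exact hc j i hj.1 (by omega) hi2
      exact (Submonoid.mem_centralizer_iff.1 (hle hW) (P j) rfl).symm
    refine ⟨W * parityLayer P q (a + k) (e - a - k), ?_, ?_⟩
    · refine mul_mem (Submonoid.closure_mono ?_ hW) (list_prod_mem fun p hp => ?_)
      · rintro _ ⟨j, h1, h2, h3, rfl⟩
        exact ⟨j, h1, h2, by simp; omega, rfl⟩
      · simp only [List.mem_map, List.mem_filter, List.mem_range'_1] at hp
        obtain ⟨j, ⟨hj, -⟩, rfl⟩ := hp
        exact Submonoid.subset_closure ⟨j, by omega, by omega, by simp; omega, rfl⟩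
    · rw [List.map_append, List.prod_append, ← mul_assoc, hxW, List.map_singleton,
        List.prod_singleton, hsplit, mul_assoc x W, ← mul_assoc W, hFW.eq, mul_assoc, ← mul_assoc x,
        hF]

/-- With at most `c - b + 1` layers the cone has not descended below `b`, so what `x` does not
absorb, `y` does. -/
lemma mul_layers_mul {R : Type*} [Monoid R] {P : ℕ → R} {a b c e : ℕ} (hac : a ≤ c)
    (hbc : b ≤ c) (hce : c ≤ e)
    (hc : ∀ i j, a ≤ i → i + 2 ≤ j → j < e → Commute (P i) (P j)) {x y : R}
    (hx : ∀ j, a ≤ j → j < c → x * P j = x) (hy : ∀ j, b ≤ j → j < e → P j * y = y)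
    (qs : List ℕ) (hlen : qs.length ≤ c - b + 1) :
    x * (qs.map fun q => parityLayer P q a (e - a)).prod * y = x * y := by
  obtain ⟨W, hW, hxW⟩ := exists_lightCone hac hce hc hx qs
  have hWy : W * y = y := by
    refine Submonoid.closure_induction (motive := fun W _ => W * y = y) ?_ (one_mul y) ?_ hW
    · rintro _ ⟨j, h1, h2, h3, rfl⟩
      exact hy j (by omega) h2
    · intro u v _ _ hu hv
      rw [mul_assoc, hv, hu]
  rw [hxW, mul_assoc, hWy]

lemma commute_parityLayer {R : Type*} [Monoid R] {P : ℕ → R} {q x len : ℕ} {y : R}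
    (h : ∀ j, x ≤ j → j < x + len → j % 2 = q → Commute y (P j)) :
    Commute y (parityLayer P q x len) := by
  refine Commute.list_prod_right _ _ fun p hp => ?_
  simp only [List.mem_map, List.mem_filter, List.mem_range'_1, decide_eq_true_eq] at hp
  obtain ⟨j, hj, rfl⟩ := hp
  exact h j hj.1.1 hj.1.2 hj.2

lemma parityLayer_mul_eq {R : Type*} [Monoid R] {P : ℕ → R} {q x len : ℕ} {y : R}
    (h : ∀ j, x ≤ j → j < x + len → P j * y = y) : parityLayer P q x len * y = y := by
  refine list_prod_mul_eq fun p hp => ?_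
  simp only [List.mem_map, List.mem_filter, List.mem_range'_1, decide_eq_true_eq] at hp
  obtain ⟨j, hj, rfl⟩ := hp
  exact h j hj.1.1 hj.1.2

section ParityLayerProjection

variable {V : Type*} [NormedAddCommGroup V] [InnerProductSpace ℂ V]
variable {P : ℕ → V →L[ℂ] V} {q x len : ℕ}

lemma commute_of_parity
    (hc : ∀ i j, x ≤ i → i + 2 ≤ j → j < x + len → i % 2 = q → j % 2 = q → Commute (P i) (P j))
    {p p' : V →L[ℂ] V} (hp : p ∈ ((List.range' x len).filter fun j => j % 2 = q).map P)
    (hp' : p' ∈ ((List.range' x len).filter fun j => j % 2 = q).map P) : Commute p p' := by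
  simp only [List.mem_map, List.mem_filter, List.mem_range'_1, decide_eq_true_eq] at hp hp'
  obtain ⟨i, hi, rfl⟩ := hp
  obtain ⟨j, hj, rfl⟩ := hp'
  rcases lt_trichotomy i j with hlt | heq | hgt
  · exact hc i j (by omega) (by omega) (by omega) hi.2 hj.2
  · rw [heq]
  · exact (hc j i (by omega) (by omega) (by omega) hj.2 hi.2).symm

variable [CompleteSpace V]

lemma isStarProjection_of_mem_parity (hP : ∀ j, x ≤ j → j < x + len → IsStarProjection (P j))
    {p : V →L[ℂ] V} (hp : p ∈ ((List.range' x len).filter fun j => j % 2 = q).map P) :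
    IsStarProjection p := by
  simp only [List.mem_map, List.mem_filter, List.mem_range'_1, decide_eq_true_eq] at hp
  obtain ⟨j, hj, rfl⟩ := hp
  exact hP j hj.1.1 hj.1.2

lemma isStarProjection_parityLayer (hP : ∀ j, x ≤ j → j < x + len → IsStarProjection (P j))
    (hc : ∀ i j, x ≤ i → i + 2 ≤ j → j < x + len → i % 2 = q → j % 2 = q → Commute (P i) (P j)) :
    IsStarProjection (parityLayer P q x len) :=
  isStarProjection_list_prod (fun _ hp => isStarProjection_of_mem_parity hP hp)
    fun _ hp _ hp' => commute_of_parity hc hp hp'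

lemma norm_one_sub_parityLayer_sq_le
    (hP : ∀ j, x ≤ j → j < x + len → IsStarProjection (P j))
    (hc : ∀ i j, x ≤ i → i + 2 ≤ j → j < x + len → i % 2 = q → j % 2 = q → Commute (P i) (P j))
    (v : V) :
    ‖(1 - parityLayer P q x len) v‖ ^ 2 ≤ ∑ j ∈ Finset.Ico x (x + len), ‖(1 - P j) v‖ ^ 2 := by
  refine (norm_one_sub_list_prod_sq_le (fun _ hp => isStarProjection_of_mem_parity hP hp)
    (fun _ hp _ hp' => commute_of_parity hc hp hp') v).trans ?_
  rw [List.map_map, ← List.sum_toFinset _ (List.Nodup.filter _ List.nodup_range')]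
  refine Finset.sum_le_sum_of_subset_of_nonneg ?_ fun _ _ _ => sq_nonneg _
  intro j hj
  simp only [List.mem_toFinset, List.mem_filter, List.mem_range'_1] at hj
  exact Finset.mem_Ico.2 hj.1

end ParityLayerProjection

end LightCone

/-! ### The merge property of a gapped chain -/

section Chain

variable {V : Type*} [NormedAddCommGroup V] [InnerProductSpace ℂ V]

lemma re_inner_partialSum (H : ℕ → V →L[ℂ] V) (S : Finset ℕ) (v : V) :
    (⟪v, partialSum H S v⟫_ℂ).re = ∑ j ∈ S, (⟪v, H j v⟫_ℂ).re := by
  rw [partialSum, sum_apply, inner_sum, Complex.re_sum]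

lemma isPositive_partialSum {H : ℕ → V →L[ℂ] V} {S : Finset ℕ}
    (hH : ∀ j ∈ S, (H j).IsPositive) : (partialSum H S).IsPositive :=
  ContinuousLinearMap.isPositive_sum S hH

variable [FiniteDimensional ℂ V]

lemma partialSum_apply_eq_zero_iff {H : ℕ → V →L[ℂ] V} {S : Finset ℕ}
    (hH : ∀ j ∈ S, (H j).IsPositive) {v : V} :
    partialSum H S v = 0 ↔ ∀ j ∈ S, H j v = 0 :=
  sum_apply_eq_zero_iff hH

/-- Only the component orthogonal to the kernel carries energy. This passes from the `H j` to
projections, to which the detectability lemma applies. -/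
lemma re_inner_le_norm_one_sub_nullProj {M : V →L[ℂ] V} (hM : M.IsPositive)
    (h1 : ∀ v, (⟪v, M v⟫_ℂ).re ≤ ‖v‖ ^ 2) (v : V) :
    (⟪v, M v⟫_ℂ).re ≤ ‖(1 - nullProj M) v‖ ^ 2 := by
  have h2 : M ((1 - nullProj M) v) = M v := by
    rw [sub_apply, map_sub, apply_nullProj, sub_zero, one_apply_eq_self]
  have h3 : ⟪nullProj M v, M v⟫_ℂ = 0 := by
    rw [← hM.inner_left_eq_inner_right, apply_nullProj, inner_zero_left]
  have h4 := h1 ((1 - nullProj M) v)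
  rw [h2, sub_apply, one_apply_eq_self, inner_sub_left, h3, sub_zero] at h4
  exact h4

variable [CompleteSpace V]

/-- One sweep of the row projectors of a gapped chain contracts the complement of the ground
space. -/
lemma norm_sweep_sq_le {H : ℕ → V →L[ℂ] V} {a e : ℕ} {Δ : ℝ} (h0 : 0 < Δ) (h1 : Δ ≤ 1)
    (hH : ∀ j ∈ Finset.Ico a e, (H j).IsPositive)
    (hle : ∀ j ∈ Finset.Ico a e, ∀ v, (⟪v, H j v⟫_ℂ).re ≤ ‖v‖ ^ 2)
    (hc : ∀ i j, a ≤ i → i + 2 ≤ j → j < e → Commute (nullProj (H i)) (nullProj (H j)))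
    (hgap : Δ ≤ gap (partialSum H (Finset.Ico a e))) {ψ : V}
    (hψ : ψ ∈ (LinearMap.ker (partialSum H (Finset.Ico a e) : V →ₗ[ℂ] V))ᗮ) :
    ‖(parityLayer (fun j => nullProj (H j)) 0 a (e - a) *
      parityLayer (fun j => nullProj (H j)) 1 a (e - a)) ψ‖ ^ 2 ≤ (1 - Δ / 8) * ‖ψ‖ ^ 2 := by
  classical
  set l : List ℕ := ((List.range' a (e - a)).filter fun j => j % 2 = 0) ++
    ((List.range' a (e - a)).filter fun j => j % 2 = 1) with hl
  have hmem : ∀ j, j ∈ l ↔ j ∈ Finset.Ico a e := by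
    intro j
    simp only [hl, List.mem_append, List.mem_filter, List.mem_range'_1, Finset.mem_Ico,
      decide_eq_true_eq]
    omega
  have hset : l.toFinset = Finset.Ico a e := by ext j; rw [List.mem_toFinset, hmem]
  have hnd : l.Nodup := by
    rw [hl, List.nodup_append]
    refine ⟨List.Nodup.filter _ List.nodup_range', List.Nodup.filter _ List.nodup_range', ?_⟩
    intro i hi j hj
    simp only [List.mem_filter, decide_eq_true_eq] at hi hj
    omega
  set h : ℕ → V →L[ℂ] V := fun j => 1 - nullProj (H j) with hh
  have hproj : ∀ j, IsStarProjection (h j) := fun j => (isStarProjection_nullProj _).one_sub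
  have hprod : (l.map fun k => 1 - h k).prod = parityLayer (fun j => nullProj (H j)) 0 a (e - a) *
      parityLayer (fun j => nullProj (H j)) 1 a (e - a) := by
    simp only [hh, sub_sub_cancel, hl, List.map_append, List.prod_append, parityLayer]
  have hcard : ∀ k ∈ l, (l.toFinset.filter fun b => ¬ Commute (h k) (h b)).card ≤ 2 := by
    intro k hk
    refine (Finset.card_le_card (t := {k - 1, k + 1}) ?_).trans Finset.card_le_two
    intro b hb
    rw [hset, Finset.mem_filter, Finset.mem_Ico] at hb
    rw [hmem, Finset.mem_Ico] at hk
    by_contra hcon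
    simp only [Finset.mem_insert, Finset.mem_singleton, not_or] at hcon
    apply hb.2
    have hcomm : ∀ i j, Commute (nullProj (H i)) (nullProj (H j)) → Commute (h i) (h j) :=
      fun i j hij => ((Commute.one_left _).sub_left ((Commute.one_right _).sub_right hij))
    rcases lt_trichotomy b k with hlt | heq | hgt
    · exact (hcomm b k (hc b k (by omega) (by omega) (by omega))).symm
    · rw [heq]
    · exact hcomm k b (hc k b (by omega) (by omega) (by omega))
  have hDL := sum_norm_sq_le_of_card_le h l hnd (fun k _ => hproj k) 2 hcard ψ
  rw [hprod, hset] at hDL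
  set φ := (parityLayer (fun j => nullProj (H j)) 0 a (e - a) *
      parityLayer (fun j => nullProj (H j)) 1 a (e - a)) ψ with hφ
  have hφmem : φ ∈ (LinearMap.ker (partialSum H (Finset.Ico a e) : V →ₗ[ℂ] V))ᗮ := by
    rw [hφ, ← hprod]
    refine list_prod_mem_orthogonal ?_ ?_ hψ
    · intro p hp
      obtain ⟨j, -, rfl⟩ := List.mem_map.1 hp
      exact (hproj j).one_sub.isSelfAdjoint
    · intro p hp v hv
      obtain ⟨j, hj, rfl⟩ := List.mem_map.1 hp
      simp only [hh, sub_sub_cancel]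
      exact nullProj_apply_eq_self ((partialSum_apply_eq_zero_iff hH).1 hv j ((hmem j).1 hj))
  have hE := gap_mul_norm_sq_le (isPositive_partialSum hH) hφmem
  rw [re_inner_partialSum] at hE
  have hE2 : ∑ j ∈ Finset.Ico a e, (⟪φ, H j φ⟫_ℂ).re ≤ ∑ j ∈ Finset.Ico a e, ‖h j φ‖ ^ 2 :=
    Finset.sum_le_sum fun j hj => re_inner_le_norm_one_sub_nullProj (hH j hj) (hle j hj) φ
  have hE3 : Δ * ‖φ‖ ^ 2 ≤ gap (partialSum H (Finset.Ico a e)) * ‖φ‖ ^ 2 := by gcongr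
  push_cast at hDL
  -- Detectability with `g = 2` gives `Δ‖φ‖² ≤ 4(‖ψ‖² - ‖φ‖²)`, and `4 / (4 + Δ) ≤ 1 - Δ / 8`.
  have hfin : (4 + Δ) * ‖φ‖ ^ 2 ≤ 4 * ‖ψ‖ ^ 2 := by linarith
  have hψ0 := sq_nonneg ‖ψ‖
  have h5 : 4 * ‖ψ‖ ^ 2 ≤ (4 + Δ) * ((1 - Δ / 8) * ‖ψ‖ ^ 2) := by
    have : 0 ≤ (Δ * (4 - Δ)) * ‖ψ‖ ^ 2 := by
      refine mul_nonneg (mul_nonneg h0.le ?_) hψ0; linarith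
    nlinarith
  exact le_of_mul_le_mul_left (hfin.trans h5) (by linarith)

lemma commute_nullProj_nullProj {M N : V →L[ℂ] V} (hM : IsSelfAdjoint M) (h : Commute M N) :
    Commute (nullProj M) (nullProj N) :=
  (commute_nullProj (isStarProjection_nullProj N).isSelfAdjoint (commute_nullProj hM h).symm).symm

lemma norm_one_sub_nullProj_le (M : V →L[ℂ] V) : ‖1 - nullProj M‖ ≤ 1 :=
  (isStarProjection_nullProj M).one_sub.norm_le

/-- The merge property of a gapped frustration-free chain with nearest-neighbour interactions. -/
theorem norm_nullProj_mul_sub_le {H : ℕ → V →L[ℂ] V} {a b c e : ℕ} (hab : a ≤ b) (hbc : b ≤ c)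
    (hce : c ≤ e) {Δ Δ' : ℝ} (h0 : 0 < Δ) (h1 : Δ ≤ 1) (h0' : 0 < Δ') (h1' : 128 * Δ' ≤ Δ)
    (hH : ∀ j ∈ Finset.Ico a e, (H j).IsPositive)
    (hle : ∀ j ∈ Finset.Ico a e, ∀ v, (⟪v, H j v⟫_ℂ).re ≤ ‖v‖ ^ 2)
    (hcH : ∀ i j, a ≤ i → i + 2 ≤ j → j < e → Commute (H i) (H j))
    (hgap : Δ ≤ gap (partialSum H (Finset.Ico a e))) :
    ‖nullProj (partialSum H (Finset.Ico a c)) * nullProj (partialSum H (Finset.Ico b e)) -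
        nullProj (partialSum H (Finset.Ico a e))‖
      ≤ 2 * Real.exp (-((c - b : ℕ) : ℝ) * √Δ') := by
  set P : ℕ → V →L[ℂ] V := fun j => nullProj (H j) with hP
  have hc : ∀ i j, a ≤ i → i + 2 ≤ j → j < e → Commute (P i) (P j) := fun i j hi hij hj =>
    commute_nullProj_nullProj (hH i (Finset.mem_Ico.2 ⟨hi, by omega⟩)).isSelfAdjoint
      (hcH i j hi hij hj)
  have hker : ∀ x y, a ≤ x → y ≤ e → ∀ v, partialSum H (Finset.Ico x y) v = 0 ↔
      ∀ j ∈ Finset.Ico x y, H j v = 0 := fun x y hx hy v =>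
    partialSum_apply_eq_zero_iff fun j hj => hH j (Finset.Ico_subset_Ico hx hy hj)
  have hsub : ∀ x y x' y', a ≤ x → y ≤ e → x ≤ x' → y' ≤ y → ∀ v,
      partialSum H (Finset.Ico x y) v = 0 → partialSum H (Finset.Ico x' y') v = 0 := by
    intro x y x' y' hx hy hxx hyy v hv
    rw [hker x' y' (hx.trans hxx) (hyy.trans hy)]
    exact fun j hj => (hker x y hx hy v).1 hv j (Finset.Ico_subset_Ico hxx hyy hj)
  have hsing : ∀ x y j, a ≤ x → y ≤ e → x ≤ j → j < y → ∀ v,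
      partialSum H (Finset.Ico x y) v = 0 → H j v = 0 := fun x y j hx hy h1 h2 v hv =>
    (hker x y hx hy v).1 hv j (Finset.mem_Ico.2 ⟨h1, h2⟩)
  set Q := nullProj (partialSum H (Finset.Ico a e)) with hQ
  set x := nullProj (partialSum H (Finset.Ico a c)) with hx
  set y := nullProj (partialSum H (Finset.Ico b e)) with hy
  have hQs : IsStarProjection Q := isStarProjection_nullProj _
  have hxQ : x * Q = Q := nullProj_mul_of_ker_le (hsub a e a c le_rfl le_rfl le_rfl hce)
  have hQy : Q * y = Q := nullProj_mul_of_ker_le' (hsub a e b e le_rfl le_rfl hab le_rfl)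
  have hsandwich : ∀ T : V →L[ℂ] V, x * T * y = x * y → ‖x * y - Q‖ ≤ ‖T - Q‖ := by
    intro T hT
    have : x * y - Q = x * (T - Q) * y := by
      rw [mul_sub, sub_mul, hT, hxQ, hQy]
    rw [this]
    calc ‖x * (T - Q) * y‖ ≤ ‖x‖ * ‖T - Q‖ * ‖y‖ :=
          (norm_mul_le _ _).trans (mul_le_mul_of_nonneg_right (norm_mul_le _ _) (norm_nonneg _))
      _ ≤ 1 * ‖T - Q‖ * 1 := by
          gcongr
          · exact norm_nullProj_le _
          · exact norm_nullProj_le _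
      _ = _ := by ring
  -- For `|B| ≤ 1` the trivial bound `1` suffices, as `√Δ' ≤ 1 / 2` makes the right side at least
  -- `1`.
  rcases Nat.lt_or_ge (c - b) 2 with hB | hB
  · have h2 := (hsandwich 1 (by rw [mul_one])).trans (norm_one_sub_nullProj_le _)
    have h3 : √Δ' ≤ 1 / 2 := by
      rw [Real.sqrt_le_left (by norm_num)]; linarith
    have h4 : ((c - b : ℕ) : ℝ) ≤ 1 := by exact_mod_cast Nat.lt_succ_iff.1 hB
    have h5 : ((c - b : ℕ) : ℝ) * √Δ' ≤ 1 * (1 / 2) := by gcongr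
    have h6 := Real.add_one_le_exp (-((c - b : ℕ) : ℝ) * √Δ')
    linarith
  -- `X ^ k` is a word of `3 k` layers, and the light cone allows `|B| + 1` of them.
  set m := (c - b + 1) / 3 with hm
  have hδ0 : 0 < Δ / 8 := by linarith
  obtain ⟨q, hqdeg, hq1, hqle⟩ := exists_chebyshev_filter hδ0 (by linarith : Δ / 8 < 1) m
  set E := parityLayer P 0 a (e - a) with hE
  set O := parityLayer P 1 a (e - a) with hO
  set X := O * (E * O) with hX
  have hlayer : ∀ r, IsStarProjection (parityLayer P r a (e - a)) := by
    intro r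
    exact isStarProjection_parityLayer (fun _ _ _ => isStarProjection_nullProj _)
      fun i j hi hij hj _ _ => hc i j hi hij (by omega)
  have hlayerQ : ∀ r, parityLayer P r a (e - a) * Q = Q := by
    intro r
    exact parityLayer_mul_eq fun j h2 h3 =>
      nullProj_mul_of_ker_le (hsing a e j le_rfl le_rfl h2 (by omega))
  have hQlayer : ∀ r, Q * parityLayer P r a (e - a) = Q := by
    intro r
    have h2 := congrArg star (hlayerQ r)
    rwa [star_mul, hQs.isSelfAdjoint.star_eq, (hlayer r).isSelfAdjoint.star_eq] at h2
  have hXQ : X * Q = Q := by rw [hX, mul_assoc, mul_assoc, hlayerQ, hlayerQ, hlayerQ]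
  have hQX : Q * X = Q := by rw [hX, ← mul_assoc, ← mul_assoc, hQlayer, hQlayer, hQlayer]
  -- Since `E` is idempotent, `O E O` is `(E O)` preceded by its adjoint; positivity and norm of `X
  -- - Q` both come from `F`.
  set F := E * O - Q with hF
  have hXF : X - Q = star F * F := by
    rw [hF, star_sub, star_mul, hQs.isSelfAdjoint.star_eq, (hlayer 0).isSelfAdjoint.star_eq,
      (hlayer 1).isSelfAdjoint.star_eq, sub_mul, mul_sub, mul_sub, mul_assoc O E Q, hlayerQ, hlayerQ,
      ← mul_assoc Q E O, hQlayer, hQlayer, hQs.isIdempotentElem.eq, sub_self, sub_zero, hX,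
      mul_assoc O E (E * O), ← mul_assoc E E O, (hlayer 0).isIdempotentElem.eq]
  have hFnorm : ‖F‖ ^ 2 ≤ 1 - Δ / 8 := by
    have h2 : ‖F‖ ≤ √(1 - Δ / 8) := by
      refine ContinuousLinearMap.opNorm_le_bound _ (Real.sqrt_nonneg _) fun v => ?_
      have h3 : F v = (E * O) (v - Q v) := by
        have : (E * O) (Q v) = Q v := by
          have h4 : E * O * Q = Q := by rw [mul_assoc, hlayerQ, hlayerQ]
          exact DFunLike.congr_fun h4 v
        rw [map_sub, this]; rfl
      have h5 := norm_sweep_sq_le h0 h1 hH hle hc hgap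
        (sub_nullProj_mem_orthogonal (partialSum H (Finset.Ico a e)) v)
      have h6 : ‖v - Q v‖ ≤ ‖v‖ := norm_isStarProjection_apply_le hQs.one_sub v
      rw [h3]
      refine (Real.le_sqrt (norm_nonneg _)
        (mul_nonneg (by linarith) (by positivity))).2 h5 |>.trans ?_
      rw [Real.sqrt_mul (by linarith), Real.sqrt_sq (norm_nonneg _)]
      gcongr
    calc ‖F‖ ^ 2 ≤ √(1 - Δ / 8) ^ 2 := by gcongr
      _ = _ := Real.sq_sqrt (by linarith)
  have hYnorm : ‖X - Q‖ ≤ 1 - Δ / 8 := by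
    rw [hXF, CStarRing.norm_star_mul_self, ← sq]; exact hFnorm
  have hYpos : 0 ≤ X - Q := by rw [hXF]; exact star_mul_self_nonneg F
  have hqX : ‖Polynomial.aeval X q - Q‖ ≤ 2 * Real.exp (-(m * √(Δ / 8))) := by
    rw [aeval_sub_eq hQs.isIdempotentElem.eq hXQ hQX hq1]
    refine (norm_mul_le _ _).trans ?_
    calc _ ≤ 2 * Real.exp (-(m * √(Δ / 8))) * 1 := by
          gcongr
          · exact norm_aeval_le_of_nonneg hYpos hYnorm (by positivity) hqle
          · exact norm_one_sub_nullProj_le _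
      _ = _ := mul_one _
  have hlight : x * Polynomial.aeval X q * y = x * y := by
    rw [mul_aeval_mul_eq (z := x * y), hq1, one_smul]
    intro k hk
    have hword : X ^ k = (((List.replicate k [1, 0, 1]).flatten).map
        fun r => parityLayer P r a (e - a)).prod := by
      rw [hX]
      clear hk
      induction k with
      | zero => simp
      | succ k ih => rw [pow_succ', ih, List.replicate_succ]; simp [mul_assoc, hE, hO]
    rw [hword]
    refine mul_layers_mul (hab.trans hbc) hbc hce hc ?_ ?_ _ ?_
    · exact fun j h1 h2 => nullProj_mul_of_ker_le' (hsing a c j le_rfl hce h1 h2)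
    · exact fun j h1 h2 => nullProj_mul_of_ker_le (hsing b e j hab le_rfl h1 h2)
    · simp; omega
  refine (hsandwich _ hlight).trans (hqX.trans ?_)
  -- `128 = 16 · 8`: the `8` is from the sweep, and `16 = 4 ^ 2` pays for `|B| ≤ 4 m`, valid once
  -- `|B| ≥ 2`.
  have h2 : 4 * √Δ' ≤ √(Δ / 8) := by
    rw [Real.le_sqrt (by positivity) hδ0.le, mul_pow, Real.sq_sqrt h0'.le]; linarith
  have h3 : ((c - b : ℕ) : ℝ) ≤ 4 * m := by
    have : c - b ≤ 4 * m := by omega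
    exact_mod_cast this
  have h4 : ((c - b : ℕ) : ℝ) * √Δ' ≤ m * √(Δ / 8) := by
    calc _ ≤ (4 * (m : ℝ)) * √Δ' := by gcongr
      _ = m * (4 * √Δ') := by ring
      _ ≤ _ := by gcongr
  have h5 : Real.exp (-(m * √(Δ / 8))) ≤ Real.exp (-((c - b : ℕ) : ℝ) * √Δ') := by
    rw [Real.exp_le_exp]; linarith
  linarith

end Chain

/-! ### Operators with disjoint supports -/

section Locality

variable {ι : Type} [Fintype ι] [DecidableEq ι] {d : ℕ}

lemma apply_eq_sum_single (A : QuditSpace ι d →L[ℂ] QuditSpace ι d) (v : QuditSpace ι d)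
    (x : ι → Fin d) : A v x = ∑ y, v y * A (EuclideanSpace.single y 1) x := by
  have hv : v = ∑ y, v y • EuclideanSpace.single y (1 : ℂ) := by
    ext z
    simp [Finset.sum_apply, Pi.single_apply]
  conv_lhs => rw [hv]
  simp [Finset.sum_apply]

/-- The matrix elements of the product of two operators with disjoint supports. -/
lemma apply_apply_single_of_disjoint {T T' : Finset ι} (hT : Disjoint T T')
    {A B : QuditSpace ι d →L[ℂ] QuditSpace ι d} {α : Matrix (T → Fin d) (T → Fin d) ℂ}
    {β : Matrix (T' → Fin d) (T' → Fin d) ℂ}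
    (hA : ∀ x y : ι → Fin d, A (EuclideanSpace.single y 1) x =
      if ∀ s, s ∉ T → x s = y s then α (fun s => x s) (fun s => y s) else 0)
    (hB : ∀ x y : ι → Fin d, B (EuclideanSpace.single y 1) x =
      if ∀ s, s ∉ T' → x s = y s then β (fun s => x s) (fun s => y s) else 0)
    (x z : ι → Fin d) :
    A (B (EuclideanSpace.single z 1)) x =
      if ∀ s, s ∉ T → s ∉ T' → x s = z s then
        α (fun s => x s) (fun s => z s) * β (fun s => x s) (fun s => z s) else 0 := by
  rw [apply_eq_sum_single]
  -- The only contributing intermediate configuration: `B` cannot change `T`, and `A` cannot change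
  -- its complement.
  set y₀ : ι → Fin d := fun s => if s ∈ T then z s else x s with hy₀
  rw [Finset.sum_eq_single y₀]
  · have h1 : ∀ s, s ∉ T → x s = y₀ s := fun s hs => by simp [hy₀, hs]
    have h2 : (fun s : T => y₀ s) = fun s : T => z s := by
      funext s; simp [hy₀]
    have h3 : (fun s : T' => y₀ s) = fun s : T' => x s := by
      funext s
      have : (s : ι) ∉ T := fun hs => Finset.disjoint_left.1 hT hs s.2
      simp [hy₀, this]
    rw [hA, hB, if_pos h1, h2, h3]
    have h4 : (∀ s, s ∉ T' → y₀ s = z s) ↔ ∀ s, s ∉ T → s ∉ T' → x s = z s := by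
      constructor
      · intro h s hs hs'
        rw [h1 s hs, h s hs']
      · intro h s hs'
        by_cases hs : s ∈ T
        · simp [hy₀, hs]
        · rw [← h1 s hs, h s hs hs']
    simp only [h4, ite_mul, zero_mul]
    rw [mul_comm]
  · intro y _ hy
    rw [hA, hB]
    by_cases h1 : ∀ s, s ∉ T' → y s = z s
    · by_cases h2 : ∀ s, s ∉ T → x s = y s
      · exfalso
        apply hy
        funext s
        by_cases hs : s ∈ T
        · simp [hy₀, hs, h1 s (Finset.disjoint_left.1 hT hs)]
        · simp [hy₀, hs, h2 s hs]
      · rw [if_neg h2, mul_zero]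
    · rw [if_neg h1, zero_mul]
  · simp

/-- Operators with disjoint supports commute. -/
lemma ActsOn.commute {T T' : Finset ι} (hT : Disjoint T T')
    {A B : QuditSpace ι d →L[ℂ] QuditSpace ι d} (hA : ActsOn T A) (hB : ActsOn T' B) :
    Commute A B := by
  obtain ⟨α, hα⟩ := hA
  obtain ⟨β, hβ⟩ := hB
  have key : ∀ z : ι → Fin d, A (B (EuclideanSpace.single z 1)) = B (A (EuclideanSpace.single z 1)) := by
    intro z
    ext x
    rw [apply_apply_single_of_disjoint hT hα hβ, apply_apply_single_of_disjoint hT.symm hβ hα]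
    have : (∀ s, s ∉ T → s ∉ T' → x s = z s) ↔ ∀ s, s ∉ T' → s ∉ T → x s = z s :=
      forall_congr' fun s => ⟨fun h h1 h2 => h h2 h1, fun h h1 h2 => h h2 h1⟩
    simp only [this, mul_comm]
  have hlin : ((A * B : QuditSpace ι d →L[ℂ] QuditSpace ι d) : QuditSpace ι d →ₗ[ℂ] QuditSpace ι d)
      = (B * A : QuditSpace ι d →L[ℂ] QuditSpace ι d) :=
    (EuclideanSpace.basisFun (ι → Fin d) ℂ).toBasis.ext fun z => by simpa using key z
  ext1 v
  exact LinearMap.congr_fun hlin v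

end Locality

/-! ### Plaquette terms, the local gap and row layers -/

namespace GridSystem

variable {L n d : ℕ} (G : GridSystem L n d)

lemma mem_positions {i j : ℕ} : (i, j) ∈ positions L n ↔ (1 ≤ i ∧ i < L) ∧ 1 ≤ j ∧ j ≤ n := by
  simp [positions]

lemma disjoint_plaquette {i j i' j' : ℕ}
    (h : i + 2 ≤ i' ∨ i' + 2 ≤ i ∨ j + 2 ≤ j' ∨ j' + 2 ≤ j) :
    Disjoint (plaquette L n i j) (plaquette L n i' j') := by
  rw [Finset.disjoint_left]
  intro s hs hs'
  simp only [plaquette, Finset.mem_filter, Finset.mem_univ, true_and] at hs hs'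
  omega

lemma commute_h {i j i' j' : ℕ} (hp : (i, j) ∈ positions L n) (hp' : (i', j') ∈ positions L n)
    (h : i + 2 ≤ i' ∨ i' + 2 ≤ i ∨ j + 2 ≤ j' ∨ j' + 2 ≤ j) : Commute (G.h i j) (G.h i' j') :=
  ActsOn.commute (disjoint_plaquette h) (G.isLocal _ hp) (G.isLocal _ hp')

lemma isPositive_h {i j : ℕ} (hp : (i, j) ∈ positions L n) : (G.h i j).IsPositive :=
  ContinuousLinearMap.IsPositive.of_isStarProjection (G.projector _ hp)

lemma isPositive_sum_h {S : Finset (ℕ × ℕ)} (hS : S ⊆ positions L n) :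
    (∑ p ∈ S, G.h p.1 p.2).IsPositive :=
  ContinuousLinearMap.isPositive_sum S fun _ hp => G.isPositive_h (hS hp)

lemma localGap_pos : 0 < G.localGap := by
  unfold localGap
  refine (Finset.lt_inf'_iff _).2 ?_
  exact fun S hS => gap_pos (G.isPositive_sum_h (Finset.mem_powerset.1 hS))

lemma localGap_le {S : Finset (ℕ × ℕ)} (hS : S ⊆ positions L n) :
    G.localGap ≤ gap (∑ p ∈ S, G.h p.1 p.2) := by
  unfold localGap
  exact Finset.inf'_le _ (Finset.mem_powerset.2 hS)

/-- The empty set of positions has gap `1` by convention. -/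
lemma localGap_le_one : G.localGap ≤ 1 := by
  simpa [gap] using G.localGap_le (Finset.empty_subset (positions L n))

/-- Positions whose terms do not commute are neighbours. -/
lemma card_not_commute_le {l : Finset (ℕ × ℕ)} (hl : l ⊆ positions L n) {p : ℕ × ℕ} (hp : p ∈ l)
    [DecidablePred fun b : ℕ × ℕ => ¬ Commute (G.h p.1 p.2) (G.h b.1 b.2)] :
    (l.filter fun b => ¬ Commute (G.h p.1 p.2) (G.h b.1 b.2)).card ≤ 9 := by
  refine (Finset.card_le_card (t := Finset.Icc (p.1 - 1) (p.1 + 1) ×ˢ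
    Finset.Icc (p.2 - 1) (p.2 + 1)) ?_).trans ?_
  · intro b hb
    rw [Finset.mem_filter] at hb
    by_contra hcon
    apply hb.2
    refine G.commute_h (hl hp) (hl hb.1) ?_
    simp only [Finset.mem_product, Finset.mem_Icc] at hcon
    omega
  · rw [Finset.card_product, Nat.card_Icc, Nat.card_Icc]
    exact Nat.mul_le_mul (by omega : _ ≤ 3) (by omega : _ ≤ 3)

/-- The projector that is the product of `1 - h_{ij}` over the columns `i` of parity `p` in an
interval of row `j`. -/
def rowLayer (p x len j : ℕ) : QuditSpace (Site L n) d →L[ℂ] QuditSpace (Site L n) d :=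
  parityLayer (fun i => 1 - G.h i j) p x len

variable {G}

lemma commute_one_sub_h {i j i' j' : ℕ} (hp : (i, j) ∈ positions L n)
    (hp' : (i', j') ∈ positions L n)
    (h : i + 2 ≤ i' ∨ i' + 2 ≤ i ∨ j + 2 ≤ j' ∨ j' + 2 ≤ j) :
    Commute (1 - G.h i j) (1 - G.h i' j') :=
  (Commute.one_left _).sub_left ((Commute.one_right _).sub_right (G.commute_h hp hp' h))

lemma isStarProjection_rowLayer {p x len j : ℕ} (hx : 1 ≤ x) (hlen : x + len ≤ L) (hj : 1 ≤ j)
    (hjn : j ≤ n) : IsStarProjection (G.rowLayer p x len j) :=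
  isStarProjection_parityLayer
    (fun _ _ _ => (G.projector (_, j) (mem_positions.2 (by omega))).one_sub)
    fun _ _ _ _ _ _ _ => commute_one_sub_h (mem_positions.2 (by omega))
      (mem_positions.2 (by omega)) (by omega)

/-- Disjoint intervals may touch: equal column parity keeps the terms at distance two. -/
lemma commute_rowLayer {p x len j x' len' j' : ℕ} (hx : 1 ≤ x) (hlen : x + len ≤ L)
    (hj : 1 ≤ j) (hjn : j ≤ n) (hx' : 1 ≤ x') (hlen' : x' + len' ≤ L) (hj' : 1 ≤ j') (hjn' : j' ≤ n)
    (h : x + len ≤ x' ∨ j + 2 ≤ j') :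
    Commute (G.rowLayer p x len j) (G.rowLayer p x' len' j') :=
  commute_parityLayer fun i' _ _ _ => (commute_parityLayer fun i _ _ _ =>
    commute_one_sub_h (mem_positions.2 (by omega)) (mem_positions.2 (by omega)) (by omega)).symm

/-- The row layer of an interval loses no more norm than the row projector. -/
lemma norm_one_sub_rowLayer_le_rowProj {p x len j : ℕ} (hx : 1 ≤ x) (hlen : x + len ≤ L)
    (hj : 1 ≤ j) (hjn : j ≤ n) (v : QuditSpace (Site L n) d) :
    ‖(1 - G.rowLayer p x len j) v‖ ≤ ‖(1 - G.rowProj (Finset.Ico x (x + len)) j) v‖ := by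
  have h1 : G.rowLayer p x len j * G.rowProj (Finset.Ico x (x + len)) j
      = G.rowProj (Finset.Ico x (x + len)) j := by
    refine parityLayer_mul_eq fun i hi hi' => ?_
    have h2 : G.h i j * G.rowProj (Finset.Ico x (x + len)) j = 0 := by
      ext1 v
      refine (sum_apply_eq_zero_iff (M := fun i => G.h i j) ?_).1
        (apply_nullProj (∑ i ∈ Finset.Ico x (x + len), G.h i j) v) i (Finset.mem_Ico.2 ⟨hi, hi'⟩)
      intro k hk
      rw [Finset.mem_Ico] at hk
      exact G.isPositive_h (mem_positions.2 (by omega))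
    rw [sub_mul, one_mul, h2, sub_zero]
  -- The layer fixes the range of the row projector, so it loses only part of the complement,
  -- however long the interval.
  have h2 : 1 - G.rowLayer p x len j
      = (1 - G.rowLayer p x len j) * (1 - G.rowProj (Finset.Ico x (x + len)) j) := by
    rw [mul_sub, mul_one, sub_mul _ _ (G.rowProj _ j), h1, one_mul, sub_self, sub_zero]
  rw [h2]
  exact norm_isStarProjection_apply_le (isStarProjection_rowLayer hx hlen hj hjn).one_sub _

lemma norm_one_sub_rowLayer_sq_le_sum {p x len j : ℕ} (hx : 1 ≤ x) (hlen : x + len ≤ L)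
    (hj : 1 ≤ j) (hjn : j ≤ n) (v : QuditSpace (Site L n) d) :
    ‖(1 - G.rowLayer p x len j) v‖ ^ 2 ≤ ∑ i ∈ Finset.Ico x (x + len), ‖G.h i j v‖ ^ 2 := by
  refine (norm_one_sub_parityLayer_sq_le
    (fun _ _ _ => (G.projector (_, j) (mem_positions.2 (by omega))).one_sub)
    (fun _ _ _ _ _ _ _ => commute_one_sub_h (mem_positions.2 (by omega))
      (mem_positions.2 (by omega)) (by omega)) v).trans ?_
  simp only [sub_sub_cancel, le_refl]

/-- Twice the band width times the energy of the row operator. -/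
lemma re_inner_rowOp {w c j : ℕ} (hw : 2 ≤ w) (hcL : c + w ≤ L) (hj : 1 ≤ j)
    (hjn : j ≤ n) (v : QuditSpace (Site L n) d) :
    2 * w * (⟪v, G.rowOp w c j v⟫_ℂ).re
      = ∑ i ∈ Finset.Ico (c - w / 2 + 1) (c - w / 2 + w), ‖G.h i j v‖ ^ 2
        + ‖(1 - G.rowProj (Finset.Ico 1 (c - w / 2 + 1)) j) v‖ ^ 2
        + ‖(1 - G.rowProj (Finset.Ico (c - w / 2 + w) L) j) v‖ ^ 2 := by
  have h1 : ∀ i ∈ Finset.Ico (c - w / 2 + 1) (c - w / 2 + w),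
      ‖G.h i j v‖ ^ 2 = (⟪v, G.h i j v⟫_ℂ).re := by
    intro i hi
    rw [Finset.mem_Ico] at hi
    exact (re_inner_isStarProjection (G.projector (i, j) (mem_positions.2 (by omega))) v).symm
  rw [Finset.sum_congr rfl h1, ← re_inner_isStarProjection (isStarProjection_nullProj _).one_sub,
    ← re_inner_isStarProjection (isStarProjection_nullProj _).one_sub]
  have hw0 : (w : ℝ) ≠ 0 := by positivity
  have h2 : (1 / (2 * (w : ℂ))) = ((1 / (2 * (w : ℝ)) : ℝ) : ℂ) := by push_cast; rfl
  simp only [rowOp]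
  rw [h2, smul_apply, inner_smul_right, Complex.re_ofReal_mul, add_apply,
    add_apply, inner_add_right, inner_add_right, sum_apply, inner_sum, Complex.add_re,
    Complex.add_re, Complex.re_sum]
  simp only [rowProj]
  field_simp

end GridSystem

namespace GridSystem

variable {L n d : ℕ} {G : GridSystem L n d}

/-! ### Bounds and commutation for the row operators -/

section RowOperators

variable {w c j : ℕ}

lemma isPositive_rowOp (hw : 2 ≤ w) (hcL : c + w ≤ L) (hj : 1 ≤ j) (hjn : j ≤ n) :
    (G.rowOp w c j).IsPositive := by
  unfold rowOp
  refine ContinuousLinearMap.IsPositive.smul_of_nonneg (((ContinuousLinearMap.isPositive_sum _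
    fun i hi => ?_).add ?_).add ?_) ?_
  · rw [Finset.mem_Ico] at hi
    exact G.isPositive_h (mem_positions.2 (by omega))
  · exact .of_isStarProjection (isStarProjection_nullProj _).one_sub
  · exact .of_isStarProjection (isStarProjection_nullProj _).one_sub
  · have h2 : (1 / (2 * (w : ℂ))) = ((1 / (2 * (w : ℝ)) : ℝ) : ℂ) := by push_cast; rfl
    rw [h2, Complex.zero_le_real]
    positivity

lemma re_inner_rowOp_le (hw : 2 ≤ w) (hcL : c + w ≤ L) (hj : 1 ≤ j) (hjn : j ≤ n)
    (v : QuditSpace (Site L n) d) : (⟪v, G.rowOp w c j v⟫_ℂ).re ≤ ‖v‖ ^ 2 := by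
  have h1 := re_inner_rowOp (G := G) hw hcL hj hjn v
  have h2 : ∑ i ∈ Finset.Ico (c - w / 2 + 1) (c - w / 2 + w), ‖G.h i j v‖ ^ 2
      ≤ ((w - 1 : ℕ) : ℝ) * ‖v‖ ^ 2 := by
    refine (Finset.sum_le_card_nsmul _ _ (‖v‖ ^ 2) fun i hi => ?_).trans (le_of_eq ?_)
    · rw [Finset.mem_Ico] at hi
      have := norm_isStarProjection_apply_le (G.projector (i, j) (mem_positions.2 (by omega))) v
      gcongr
    · rw [Nat.card_Ico, nsmul_eq_mul]
      congr 2
      omega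
  have h3 : ∀ I, ‖(1 - G.rowProj I j) v‖ ^ 2 ≤ ‖v‖ ^ 2 := by
    intro I
    have := norm_isStarProjection_apply_le
      (isStarProjection_nullProj (∑ i ∈ I, G.h i j)).one_sub v
    unfold rowProj
    gcongr
  have h4 := h3 (Finset.Ico 1 (c - w / 2 + 1))
  have h5 := h3 (Finset.Ico (c - w / 2 + w) L)
  rw [Nat.cast_sub (by omega)] at h2
  push_cast at h2
  have hw' : (2 : ℝ) ≤ w := by exact_mod_cast hw
  -- There are `w - 1` band terms and two outer projectors, and `w + 1 ≤ 2 w`.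
  have h6 : 2 * (w : ℝ) * (⟪v, G.rowOp w c j v⟫_ℂ).re ≤ 2 * w * ‖v‖ ^ 2 := by
    nlinarith [sq_nonneg ‖v‖]
  exact le_of_mul_le_mul_left h6 (by positivity)

/-- Used so that a state orthogonal to the kernel of `H_S` is orthogonal to the common kernel of the
plaquette terms. -/
lemma rowOp_apply_eq_zero (hw : 2 ≤ w) (hcL : c + w ≤ L) {v : QuditSpace (Site L n) d}
    (hv : ∀ i, 1 ≤ i → i < L → G.h i j v = 0) : G.rowOp w c j v = 0 := by
  have h1 : ∀ I ⊆ Finset.Ico 1 L, (∑ i ∈ I, G.h i j) v = 0 := by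
    intro I hI
    rw [sum_apply]
    refine Finset.sum_eq_zero fun i hi => ?_
    have := Finset.mem_Ico.1 (hI hi)
    exact hv i this.1 this.2
  have h2 : ∀ I ⊆ Finset.Ico 1 L, (1 - G.rowProj I j) v = 0 := by
    intro I hI
    rw [sub_apply, one_apply_eq_self, rowProj, nullProj_apply_eq_self (h1 I hI), sub_self]
  simp only [rowOp]
  rw [smul_apply, add_apply, add_apply, h1, h2, h2]
  · simp
  all_goals
    refine Finset.Ico_subset_Ico ?_ ?_ <;> omega

/-- Operators on rows at distance at least two commute. -/
lemma commute_rowOp {j' : ℕ} (hw : 2 ≤ w) (hcL : c + w ≤ L) (hj : 1 ≤ j)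
    (hjj' : j + 2 ≤ j') (hjn : j' ≤ n) : Commute (G.rowOp w c j) (G.rowOp w c j') := by
  have hhh : ∀ i ∈ Finset.Ico 1 L, ∀ i' ∈ Finset.Ico 1 L, Commute (G.h i j) (G.h i' j') := by
    intro i hi i' hi'
    rw [Finset.mem_Ico] at hi hi'
    exact G.commute_h (mem_positions.2 (by omega)) (mem_positions.2 (by omega)) (by omega)
  have hsum : ∀ I ⊆ Finset.Ico 1 L, ∀ I' ⊆ Finset.Ico 1 L,
      Commute (∑ i ∈ I, G.h i j) (∑ i ∈ I', G.h i j') := fun I hI I' hI' =>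
    Commute.sum_left _ _ _ fun i hi => Commute.sum_right _ _ _ fun i' hi' =>
      hhh i (hI hi) i' (hI' hi')
  have hsa : ∀ I ⊆ Finset.Ico 1 L, ∀ k, 1 ≤ k → k ≤ n → IsSelfAdjoint (∑ i ∈ I, G.h i k) := by
    intro I hI k hk hkn
    refine (ContinuousLinearMap.isPositive_sum I fun i hi => ?_).isSelfAdjoint
    have := Finset.mem_Ico.1 (hI hi)
    exact G.isPositive_h (mem_positions.2 (by omega))
  have hsp : ∀ I ⊆ Finset.Ico 1 L, ∀ I' ⊆ Finset.Ico 1 L,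
      Commute (∑ i ∈ I, G.h i j) (1 - G.rowProj I' j') := fun I hI I' hI' =>
    (Commute.one_right _).sub_right
      (commute_nullProj (hsa I hI j hj (by omega)) (hsum I hI I' hI'))
  have hps : ∀ I ⊆ Finset.Ico 1 L, ∀ I' ⊆ Finset.Ico 1 L,
      Commute (1 - G.rowProj I j) (∑ i ∈ I', G.h i j') := fun I hI I' hI' =>
    (Commute.one_left _).sub_left
      (commute_nullProj (hsa I' hI' j' (by omega) hjn) (hsum I hI I' hI').symm).symm
  have hpp : ∀ I ⊆ Finset.Ico 1 L, ∀ I' ⊆ Finset.Ico 1 L,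
      Commute (1 - G.rowProj I j) (1 - G.rowProj I' j') := fun I hI I' hI' =>
    (Commute.one_left _).sub_left ((Commute.one_right _).sub_right
      (commute_nullProj_nullProj (hsa I hI j hj (by omega)) (hsum I hI I' hI')))
  have hB : Finset.Ico (c - w / 2 + 1) (c - w / 2 + w) ⊆ Finset.Ico 1 L :=
    Finset.Ico_subset_Ico (by omega) (by omega)
  have hL : Finset.Ico 1 (c - w / 2 + 1) ⊆ Finset.Ico 1 L :=
    Finset.Ico_subset_Ico (by omega) (by omega)
  have hR : Finset.Ico (c - w / 2 + w) L ⊆ Finset.Ico 1 L :=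
    Finset.Ico_subset_Ico (by omega) (by omega)
  simp only [rowOp]
  refine Commute.smul_left (Commute.smul_right ?_ _) _
  refine ((Commute.add_left ?_ ?_).add_left ?_) <;>
    refine ((Commute.add_right ?_ ?_).add_right ?_)
  exacts [hsum _ hB _ hB, hsp _ hB _ hL, hsp _ hB _ hR, hps _ hL _ hB, hpp _ hL _ hL, hpp _ hL _ hR,
    hps _ hR _ hB, hpp _ hR _ hL, hpp _ hR _ hR]

/-- A full row layer loses at most the (rescaled) energy of the row operator. -/
lemma norm_one_sub_rowLayer_sq_le (p : ℕ) (hw : 2 ≤ w) (hcL : c + w ≤ L) (hj : 1 ≤ j) (hjn : j ≤ n)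
    (v : QuditSpace (Site L n) d) :
    ‖(1 - G.rowLayer p 1 (L - 1) j) v‖ ^ 2 ≤ 2 * w * (⟪v, G.rowOp w c j v⟫_ℂ).re := by
  rw [re_inner_rowOp hw hcL hj hjn]
  set a := c - w / 2 with ha
  -- The three commuting factors match the three parts of the row energy, and the union bound adds
  -- their losses.
  have hsplit : G.rowLayer p 1 (L - 1) j = G.rowLayer p 1 a j *
      (G.rowLayer p (a + 1) (w - 1) j * G.rowLayer p (a + w) (L - (a + w)) j) := by
    have e1 : L - 1 = a + (w - 1 + (L - (a + w))) := by omega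
    have e2 : a + w = 1 + a + (w - 1) := by omega
    unfold rowLayer
    rw [e1, parityLayer_add, parityLayer_add, ← e2, add_comm 1 a]
  have hpL := isStarProjection_rowLayer (G := G) (p := p) (x := 1) (len := a) le_rfl (by omega) hj hjn
  have hpB := isStarProjection_rowLayer (G := G) (p := p) (x := a + 1) (len := w - 1) (by omega)
    (by omega) hj hjn
  have hpR := isStarProjection_rowLayer (G := G) (p := p) (x := a + w) (len := L - (a + w))
    (by omega) (by omega) hj hjn
  have hcLB := commute_rowLayer (G := G) (p := p) (x := 1) (len := a) (x' := a + 1) (len' := w - 1)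
    le_rfl (by omega) hj hjn (by omega) (by omega) hj hjn (by omega)
  have hcLR := commute_rowLayer (G := G) (p := p) (x := 1) (len := a) (x' := a + w)
    (len' := L - (a + w)) le_rfl (by omega) hj hjn (by omega) (by omega) hj hjn (by omega)
  have hcBR := commute_rowLayer (G := G) (p := p) (x := a + 1) (len := w - 1) (x' := a + w)
    (len' := L - (a + w)) (by omega) (by omega) hj hjn (by omega) (by omega) hj hjn (by omega)
  have h1 := norm_one_sub_mul_sq_le hpL (hpB.mul hpR hcBR) (hcLB.mul_right hcLR) v
  have h2 := norm_one_sub_mul_sq_le hpB hpR hcBR v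
  have h3 := norm_one_sub_rowLayer_le_rowProj (G := G) (p := p) (x := 1) (len := a) le_rfl
    (by omega) hj hjn v
  have h4 := norm_one_sub_rowLayer_sq_le_sum (G := G) (p := p) (x := a + 1) (len := w - 1)
    (by omega) (by omega) hj hjn v
  have h5 := norm_one_sub_rowLayer_le_rowProj (G := G) (p := p) (x := a + w) (len := L - (a + w))
    (by omega) (by omega) hj hjn v
  rw [add_comm 1 a] at h3
  rw [show a + 1 + (w - 1) = a + w by omega] at h4
  rw [show a + w + (L - (a + w)) = L by omega] at h5
  rw [hsplit]
  have h3' := pow_le_pow_left₀ (norm_nonneg _) h3 2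
  have h5' := pow_le_pow_left₀ (norm_nonneg _) h5 2
  linarith

end RowOperators

/-! ### The gap property on the grid -/

section GapProperty

variable (G) in
/-- The product of the row layers of column parity `p` over the rows of parity `q` in an
interval. -/
def gridLayer (p q k len : ℕ) : QuditSpace (Site L n) d →L[ℂ] QuditSpace (Site L n) d :=
  parityLayer (fun j => G.rowLayer p 1 (L - 1) j) q k len

variable {w c k e : ℕ}

lemma isStarProjection_gridLayer (hL : 1 ≤ L) (hk : 1 ≤ k) (he : e ≤ n + 1) (p q : ℕ) :
    IsStarProjection (G.gridLayer p q k (e - k)) :=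
  isStarProjection_parityLayer
    (fun _ _ _ => isStarProjection_rowLayer le_rfl (by omega) (by omega) (by omega))
    fun _ _ _ _ _ _ _ => commute_rowLayer le_rfl (by omega) (by omega) (by omega) le_rfl
      (by omega) (by omega) (by omega) (by omega)

lemma norm_one_sub_gridLayer_sq_le (hw : 2 ≤ w) (hcL : c + w ≤ L) (hk : 1 ≤ k) (hke : k ≤ e)
    (he : e ≤ n + 1) (p q : ℕ) (v : QuditSpace (Site L n) d) :
    ‖(1 - G.gridLayer p q k (e - k)) v‖ ^ 2
      ≤ 2 * w * (⟪v, partialSum (fun j => G.rowOp w c j) (Finset.Ico k e) v⟫_ℂ).re := by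
  rw [re_inner_partialSum, Finset.mul_sum]
  refine (norm_one_sub_parityLayer_sq_le
    (fun _ _ _ => isStarProjection_rowLayer le_rfl (by omega) (by omega) (by omega))
    (fun _ _ _ _ _ _ _ => commute_rowLayer le_rfl (by omega) (by omega) (by omega) le_rfl
      (by omega) (by omega) (by omega) (by omega)) v).trans ?_
  rw [show k + (e - k) = e by omega]
  refine Finset.sum_le_sum fun j hj => ?_
  rw [Finset.mem_Ico] at hj
  exact norm_one_sub_rowLayer_sq_le p hw hcL (by omega) (by omega) v

/-- The positions of the terms in `gridLayer p q k len`, in the order of the product. -/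
def layerPositions (L p q k len : ℕ) : List (ℕ × ℕ) :=
  ((List.range' k len).filter fun j => j % 2 = q).flatMap fun j =>
    ((List.range' 1 (L - 1)).filter fun i => i % 2 = p).map fun i => (i, j)

lemma mem_layerPositions {p q len i j : ℕ} :
    (i, j) ∈ layerPositions L p q k len ↔
      ((1 ≤ i ∧ i < L) ∧ i % 2 = p) ∧ (k ≤ j ∧ j < k + len) ∧ j % 2 = q := by
  simp only [layerPositions, List.mem_flatMap, List.mem_filter, List.mem_range'_1, List.mem_map,
    decide_eq_true_eq, Prod.mk.injEq]
  constructor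
  · rintro ⟨j', hj', i', hi', rfl, rfl⟩
    omega
  · intro h
    exact ⟨j, h.2, i, by omega, rfl, rfl⟩

lemma nodup_layerPositions (p q len : ℕ) : (layerPositions L p q k len).Nodup := by
  unfold layerPositions
  rw [List.nodup_flatMap]
  refine ⟨fun j _ => (List.Nodup.filter _ List.nodup_range').map
    fun i i' h => (Prod.mk.inj h).1, ?_⟩
  refine (List.Nodup.filter _ List.nodup_range' : List.Nodup _).imp fun {j j'} hne => ?_
  intro x hx hx'
  obtain ⟨i, -, rfl⟩ := List.mem_map.1 hx
  obtain ⟨i', -, h⟩ := List.mem_map.1 hx'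
  exact hne (Prod.mk.inj h).2.symm

lemma prod_map_layerPositions (p q len : ℕ) :
    ((layerPositions L p q k len).map fun x => 1 - G.h x.1 x.2).prod
      = G.gridLayer p q k len := by
  unfold layerPositions gridLayer
  rw [parityLayer]
  generalize (List.range' k len).filter (fun j => decide (j % 2 = q)) = l
  induction l with
  | nil => simp
  | cons j l ih =>
    rw [List.flatMap_cons, List.map_append, List.prod_append, ih, List.map_cons, List.prod_cons,
      List.map_map]
    rfl

/-- The positions of the terms in a band of rows, layer by layer. -/
def bandPositions (L k len : ℕ) : List (ℕ × ℕ) :=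
  layerPositions L 0 0 k len ++ (layerPositions L 0 1 k len ++
    (layerPositions L 1 0 k len ++ layerPositions L 1 1 k len))

lemma mem_bandPositions (hke : k ≤ e) (x : ℕ × ℕ) :
    x ∈ bandPositions L k (e - k) ↔ x ∈ Finset.Ico 1 L ×ˢ Finset.Ico k e := by
  obtain ⟨i, j⟩ := x
  simp only [bandPositions, List.mem_append, mem_layerPositions, Finset.mem_product,
    Finset.mem_Ico]
  omega

lemma nodup_bandPositions (len : ℕ) : (bandPositions L k len).Nodup := by
  simp only [bandPositions, List.nodup_append, nodup_layerPositions, true_and]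
  refine ⟨⟨?_, ?_⟩, ?_⟩ <;> rintro ⟨i, j⟩ hx ⟨i', j'⟩ hx' hxx' <;>
    simp only [List.mem_append, mem_layerPositions, Prod.mk.injEq] at hx hx' hxx' <;> omega

/-- The norm lost in the product over all layers of a band of rows. -/
lemma norm_sq_sub_norm_prod_bandPositions_sq_le (hw : 2 ≤ w) (hcL : c + w ≤ L) (hk : 1 ≤ k)
    (hke : k ≤ e) (he : e ≤ n + 1) (ψ : QuditSpace (Site L n) d)
    (h0 : 0 ≤ (⟪ψ, partialSum (fun j => G.rowOp w c j) (Finset.Ico k e) ψ⟫_ℂ).re) :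
    ‖ψ‖ ^ 2 - ‖((bandPositions L k (e - k)).map fun x => 1 - G.h x.1 x.2).prod ψ‖ ^ 2
      ≤ 128 * w * (⟪ψ, partialSum (fun j => G.rowOp w c j) (Finset.Ico k e) ψ⟫_ℂ).re := by
  set En := (⟪ψ, partialSum (fun j => G.rowOp w c j) (Finset.Ico k e) ψ⟫_ℂ).re with hEn
  set D : List (QuditSpace (Site L n) d →L[ℂ] QuditSpace (Site L n) d) :=
    [G.gridLayer 0 0 k (e - k), G.gridLayer 0 1 k (e - k), G.gridLayer 1 0 k (e - k),
      G.gridLayer 1 1 k (e - k)] with hD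
  have hprod : ((bandPositions L k (e - k)).map fun x => 1 - G.h x.1 x.2).prod = D.prod := by
    simp only [bandPositions, hD, List.map_append, List.prod_append, prod_map_layerPositions,
      List.prod_cons, List.prod_nil, mul_one]
  have h1 : ∀ p ∈ D, ‖(1 - p) ψ‖ ≤ √(2 * w * En) := by
    intro p hp
    refine Real.le_sqrt_of_sq_le ?_
    simp only [hD, List.mem_cons, List.not_mem_nil, or_false] at hp
    rcases hp with rfl | rfl | rfl | rfl <;>
      exact norm_one_sub_gridLayer_sq_le hw hcL hk hke he _ _ ψ
  have h2 : ∀ p ∈ D, IsStarProjection p := by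
    intro p hp
    simp only [hD, List.mem_cons, List.not_mem_nil, or_false] at hp
    rcases hp with rfl | rfl | rfl | rfl <;>
      exact isStarProjection_gridLayer (by omega) hk he _ _
  -- Four layers, each losing squared norm at most `2 w En`: `4 ^ 3 · 2 w = 128 w`.
  have h3 := norm_sq_sub_norm_list_prod_sq_le h2 h1
  rw [Real.sq_sqrt (by positivity), ← hprod] at h3
  have h4 : (D.length : ℝ) = 4 := by simp [hD]
  rw [h4] at h3
  linarith

/-- Split `γ a = γ b + γ (a - b)`, with `a` and `b` the squared norms before and after the sweep;
`10496 = (81 + 1) · 128`. -/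
lemma gap_arith {γ g a b s t : ℝ} (h0 : 0 ≤ γ) (h1 : γ ≤ 1) (hg : γ ≤ g) (hb : 0 ≤ b) (ht : 0 ≤ t)
    (hE : g * b ≤ s) (hs : s ≤ 9 ^ 2 * (a - b)) (hd : a - b ≤ 128 * t) : γ * a ≤ 10496 * t := by
  have h2 : γ * b ≤ g * b := mul_le_mul_of_nonneg_right hg hb
  have h3 : γ * (a - b) ≤ γ * (128 * t) := mul_le_mul_of_nonneg_left hd h0
  have h4 : γ * (128 * t) ≤ 1 * (128 * t) := mul_le_mul_of_nonneg_right h1 (by positivity)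
  linarith

/-- The gap property of the row operators. -/
theorem localGap_div_le_gap (hw : 2 ≤ w) (hcL : c + w ≤ L) (hk : 1 ≤ k) (hke : k ≤ e)
    (he : e ≤ n + 1) :
    G.localGap / (10496 * w) ≤ gap (partialSum (fun j => G.rowOp w c j) (Finset.Ico k e)) := by
  classical
  have hw' : (2 : ℝ) ≤ w := by exact_mod_cast hw
  have hγ0 := G.localGap_pos
  have hγ1 := G.localGap_le_one
  have hHpos : ∀ j ∈ Finset.Ico k e, (G.rowOp w c j).IsPositive := by
    intro j hj
    rw [Finset.mem_Ico] at hj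
    exact isPositive_rowOp hw hcL (by omega) (by omega)
  refine le_gap_of_forall (isPositive_partialSum hHpos) ?_ ?_
  · rw [div_le_one (by positivity)]; linarith
  intro ψ hψ
  set En := (⟪ψ, partialSum (fun j => G.rowOp w c j) (Finset.Ico k e) ψ⟫_ℂ).re with hEn
  set S : Finset (ℕ × ℕ) := Finset.Ico 1 L ×ˢ Finset.Ico k e with hS
  have hSpos : S ⊆ positions L n := by
    rintro ⟨i, j⟩ hij
    simp only [hS, Finset.mem_product, Finset.mem_Ico] at hij
    exact mem_positions.2 (by omega)
  set l : List (ℕ × ℕ) := bandPositions L k (e - k) with hl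
  have hmem : ∀ x, x ∈ l ↔ x ∈ S := mem_bandPositions hke
  have hset : l.toFinset = S := by ext x; rw [List.mem_toFinset, hmem]
  have hnd : l.Nodup := nodup_bandPositions _
  have hproj : ∀ x ∈ l, IsStarProjection (G.h x.1 x.2) := fun x hx =>
    G.projector x (hSpos ((hmem x).1 hx))
  have hDL := sum_norm_sq_le_of_card_le (fun x : ℕ × ℕ => G.h x.1 x.2) l hnd hproj 9
    (fun x hx => by
      rw [hset]
      exact G.card_not_commute_le hSpos ((hmem x).1 hx)) ψ
  rw [hset] at hDL
  set φ := (l.map fun x => 1 - G.h x.1 x.2).prod ψ with hφ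
  have hEn0 : 0 ≤ En := (isPositive_partialSum hHpos).re_inner_nonneg_right ψ
  have hdefect : ‖ψ‖ ^ 2 - ‖φ‖ ^ 2 ≤ 128 * w * En :=
    norm_sq_sub_norm_prod_bandPositions_sq_le hw hcL hk hke he ψ hEn0
  have hφmem : φ ∈ (LinearMap.ker ((∑ x ∈ S, G.h x.1 x.2 :
      QuditSpace (Site L n) d →L[ℂ] QuditSpace (Site L n) d) :
      QuditSpace (Site L n) d →ₗ[ℂ] QuditSpace (Site L n) d))ᗮ := by
    have hker : ∀ v, (∑ x ∈ S, G.h x.1 x.2) v = 0 → ∀ x ∈ S, G.h x.1 x.2 v = 0 := fun v hv =>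
      (sum_apply_eq_zero_iff (M := fun x : ℕ × ℕ => G.h x.1 x.2)
        fun x hx => G.isPositive_h (hSpos hx)).1 hv
    refine list_prod_mem_orthogonal ?_ ?_ (Submodule.orthogonal_le ?_ hψ)
    · intro p hp
      obtain ⟨x, hx, rfl⟩ := List.mem_map.1 hp
      exact (hproj x hx).one_sub.isSelfAdjoint
    · intro p hp v hv
      obtain ⟨x, hx, rfl⟩ := List.mem_map.1 hp
      rw [sub_apply, hker v hv x ((hmem x).1 hx), sub_zero, one_apply_eq_self]
    · intro v hv
      refine (partialSum_apply_eq_zero_iff hHpos).2 fun j hj => ?_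
      refine rowOp_apply_eq_zero hw hcL fun i hi hiL => hker v hv (i, j) ?_
      exact Finset.mem_product.2 ⟨Finset.mem_Ico.2 ⟨hi, hiL⟩, hj⟩
  have hE := gap_mul_norm_sq_le (G.isPositive_sum_h hSpos) hφmem
  have hE2 : (⟪φ, (∑ x ∈ S, G.h x.1 x.2) φ⟫_ℂ).re = ∑ x ∈ S, ‖G.h x.1 x.2 φ‖ ^ 2 := by
    rw [sum_apply, inner_sum, Complex.re_sum]
    exact Finset.sum_congr rfl fun x hx => re_inner_isStarProjection (G.projector x (hSpos hx)) φ
  rw [hE2] at hE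
  push_cast at hDL
  rw [mul_assoc] at hdefect
  have hfin := gap_arith hγ0.le hγ1 (G.localGap_le hSpos) (sq_nonneg ‖φ‖)
    (mul_nonneg (by positivity) hEn0) hE hDL hdefect
  rw [div_mul_eq_mul_div, div_le_iff₀ (by positivity)]
  exact hfin.trans (le_of_eq (by ring))

end GapProperty

end GridSystem

end GridSpin

end

/-! ### Assembly of the two properties -/

theorem mainTheorem6 :
    ∃ κ : ℝ, 0 < κ ∧
      ∀ (L n d w c : ℕ) (G : GridSpin.GridSystem L n d),
        2 ≤ w → w ≤ c → c + w ≤ L →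
          GridSpin.HasGapMerge n (fun j => G.rowOp w c j) (κ * (G.localGap / (w : ℝ))) := by
  -- `10496` comes from the gap bound; the further `128` is spent on the merge property alone.
  refine ⟨1 / (128 * 10496), by norm_num, ?_⟩
  intro L n d w c G hw _ hcL
  have hw' : (2 : ℝ) ≤ w := by exact_mod_cast hw
  have hγ0 := G.localGap_pos
  have hγ1 := G.localGap_le_one
  have hΔ0 : 0 < G.localGap / (10496 * w) := by positivity
  have hΔ1 : G.localGap / (10496 * w) ≤ 1 := by
    rw [div_le_one (by positivity)]; linarith
  have heq : 128 * (1 / (128 * 10496) * (G.localGap / (w : ℝ))) = G.localGap / (10496 * w) := by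
    field_simp
  have hpos : 0 < 1 / (128 * 10496) * (G.localGap / (w : ℝ)) := by positivity
  refine ⟨hpos, by linarith, ?_, ?_⟩
  · intro a e ha hae he
    have := GridSpin.GridSystem.localGap_div_le_gap (G := G) hw hcL ha hae he
    linarith
  · intro a b c' e ha hab hbc hce he
    rw [Finset.Ico_union_Ico_eq_Ico hab hbc, Finset.Ico_union_Ico_eq_Ico hbc hce, Nat.card_Ico]
    refine GridSpin.norm_nullProj_mul_sub_le hab hbc hce hΔ0 hΔ1 hpos heq.le ?_ ?_ ?_
      (GridSpin.GridSystem.localGap_div_le_gap hw hcL ha (by omega) he)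
    · intro j hj
      rw [Finset.mem_Ico] at hj
      exact GridSpin.GridSystem.isPositive_rowOp hw hcL (by omega) (by omega)
    · intro j hj
      rw [Finset.mem_Ico] at hj
      exact GridSpin.GridSystem.re_inner_rowOp_le hw hcL (by omega) (by omega)
    · intro i j hi hij hj
      exact GridSpin.GridSystem.commute_rowOp hw hcL (by omega) hij (by omega)
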